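/- Let $F_{12}$ be the cubic simple graph with vertices $A, A', B, B', 1, 2, \dots, 8$ and the eighteen edges $AA'$, $A3$, $A'2$, $BB'$, $B6$, $B'7$, $23$, $67$, $A8$, $A'5$, $B1$, $B'4$, $12$, $34$, $56$, $78$, $45$, $81$. For a graph $G$, a one-edge addition $G \cup e$ is a multigraph obtained from $G$ in one of three ways: (a) subdivide an edge of $G$ by a new vertex $u$, and add a further vertex $v$, an edge $uv$ and a loop at $v$; (b) subdivide an edge of $G$ by two new vertices $u, v$, and add a second edge $uv$; (c) subdivide two distinct edges $e_1, e_2$ of $G$ by new vertices $u$ and $v$, respectively, and add an edge $uv$; the result is then written $G \cup (e_1 - e_2)$. An embedding of a multigraph into the torus $T^2 = \mathbb{R}/\mathbb{Z} \times \mathbb{R}/\mathbb{Z}$ sends the vertices to distinct points and each edge to a continuous curve $[0,1] \to T^2$ that joins the images of its ends, is injective on $(0,1)$ and meets no vertex there, such that the curves of distinct edges are disjoint away from their end points. A multigraph is toroidal if it has such an embedding. An embedding of $G \cup (e_1 - e_2)$ extends an embedding of $G$ if the two agree on the vertices of $G$, each edge of $G$ other than $e_1, e_2$ has the same image under both, and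 for $i = 1, 2$ the image of $e_i$ is the union of the images of the two parts into which $e_i$ is subdivided. Then the following hold. 1. Every one-edge addition $F_{12} \cup e$ is toroidal. 2. No one-edge addition to $F_{12}$ of type (a) or (b) has girth at least four. If $F_{12} \cup (e_1 - e_2)$ has girth at least four, then some automorphism of $F_{12}$ maps the pair $\{e_1, e_2\}$ to exactly one of the following fourteen pairs (that is, there is exactly one pair in the list that is the image of $\{e_1,e_2\}$ under an automorphism); conversely, each of these fourteen pairs gives a graph of girth at least four: $AA'-BB'$, $AA'-B1$, $AA'-B6$, $AA'-12$, $AA'-23$, $AA'-45$, $AA'-56$, $AA'-67$, $A8-A'5$, $A8-B1$, $A8-B'4$, $A8-12$, $A8-45$, $45-81$. 3. There are three embeddings of $F_{12}$ into the torus (not required to be distinct) such that for each of the fourteen pairs $e_1 - e_2$ in the list at least one of them extends to an embedding of $F_{12} \cup (e_1 - e_2)$. -/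

import Mathlib

namespace Graph

variable {α β : Type*}

/-! ### One-edge additions to a multigraph

The graph obtained from `G` by a one-edge addition has two new vertices, `Sum.inr 0` (called `u`) and
`Sum.inr 1` (called `v`). The subdivided edges of `G` are removed, and the edges `Sum.inr i` are
new. -/

/-- Remove the edges in `D` from `G`, add two new vertices `Sum.inr 0`, `Sum.inr 1`, and add one
new edge `Sum.inr i` for each `i : Fin n`, with the (unordered) pair of ends `new i`. -/
def replaceEdges (G : Graph α β) (D : Set β) {n : ℕ} (new : Fin n → Sym2 (α ⊕ Fin 2)) :
    Graph (α ⊕ Fin 2) (β ⊕ Fin n) where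
  vertexSet := Sum.inl '' G.vertexSet ∪ Set.range Sum.inr
  IsLink e x y :=
    match e with
    | Sum.inl f => f ∉ D ∧ ∃ a b, G.IsLink f a b ∧ x = Sum.inl a ∧ y = Sum.inl b
    | Sum.inr i => new i = s(x, y) ∧
        x ∈ Sum.inl '' G.vertexSet ∪ Set.range Sum.inr ∧
        y ∈ Sum.inl '' G.vertexSet ∪ Set.range Sum.inr
  isLink_symm := by
    rintro (f | i) -
    · exact ⟨fun x y ⟨hD, a, b, h, hx, hy⟩ => ⟨hD, b, a, h.symm, hy, hx⟩⟩
    · exact ⟨fun x y ⟨h, hx, hy⟩ => ⟨h.trans Sym2.eq_swap, hy, hx⟩⟩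
  eq_or_eq_of_isLink_of_isLink := by
    rintro (f | i) x y v w
    · rintro ⟨-, a, b, h, rfl, rfl⟩ ⟨-, c, d, h', rfl, rfl⟩
      exact (h.left_eq_or_eq h').imp (congrArg Sum.inl) (congrArg Sum.inl)
    · rintro ⟨h, -, -⟩ ⟨h', -, -⟩
      rw [h, Sym2.eq_iff] at h'
      exact h'.imp And.left And.left
  left_mem_of_isLink := by
    rintro (f | i) x y
    · rintro ⟨-, a, b, h, rfl, rfl⟩
      exact Or.inl ⟨a, h.left_mem, rfl⟩
    · rintro ⟨-, hx, -⟩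
      exact hx

/-- First kind: subdivide the edge `e` with ends `x`, `y` by `u`, and add the vertex `v`, the edge
`uv` and a loop at `v`. -/
def addLoop (G : Graph α β) (e : β) (x y : α) : Graph (α ⊕ Fin 2) (β ⊕ Fin 4) :=
  G.replaceEdges {e}
    ![s(Sum.inl x, Sum.inr 0), s(Sum.inr 0, Sum.inl y), s(Sum.inr 0, Sum.inr 1),
      s(Sum.inr 1, Sum.inr 1)]

/-- Second kind: subdivide the edge `e` with ends `x`, `y` twice, by `u` and `v`, and add another
edge `uv`. -/
def addParallel (G : Graph α β) (e : β) (x y : α) : Graph (α ⊕ Fin 2) (β ⊕ Fin 4) :=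
  G.replaceEdges {e}
    ![s(Sum.inl x, Sum.inr 0), s(Sum.inr 0, Sum.inr 1), s(Sum.inr 1, Sum.inl y),
      s(Sum.inr 0, Sum.inr 1)]

/-- Third kind: subdivide the edge `e₁` with ends `x₁`, `y₁` by `u` and the edge `e₂` with ends
`x₂`, `y₂` by `v`, and add the edge `uv`. -/
def addChord (G : Graph α β) (e₁ : β) (x₁ y₁ : α) (e₂ : β) (x₂ y₂ : α) :
    Graph (α ⊕ Fin 2) (β ⊕ Fin 5) :=
  G.replaceEdges {e₁, e₂}
    ![s(Sum.inl x₁, Sum.inr 0), s(Sum.inr 0, Sum.inl y₁),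
      s(Sum.inl x₂, Sum.inr 1), s(Sum.inr 1, Sum.inl y₂),
      s(Sum.inr 0, Sum.inr 1)]

/-- `G.IsOneEdgeAddition H` says that `H` is one of the graphs `G ∪ e`. -/
inductive IsOneEdgeAddition (G : Graph α β) :
    {n : ℕ} → Graph (α ⊕ Fin 2) (β ⊕ Fin n) → Prop
  | loop (e : β) (x y : α) (h : G.IsLink e x y) : IsOneEdgeAddition G (G.addLoop e x y)
  | parallel (e : β) (x y : α) (h : G.IsLink e x y) : IsOneEdgeAddition G (G.addParallel e x y)
  | chord (e₁ e₂ : β) (x₁ y₁ x₂ y₂ : α) (h₁ : G.IsLink e₁ x₁ y₁) (h₂ : G.IsLink e₂ x₂ y₂)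
      (hne : e₁ ≠ e₂) : IsOneEdgeAddition G (G.addChord e₁ x₁ y₁ e₂ x₂ y₂)

/-- The graph has no cycle of length at most three: it has neither loops nor parallel edges, and the
girth of its simple graph is at least four. -/
def GirthGeFour (G : Graph α β) : Prop :=
  G.Simple ∧ 4 ≤ G.toSimpleGraph.egirth

/-! ### Embeddings into a topological space -/

/-- The vertex map `p` and the curves `γ` embed the multigraph `G` into `X`: vertices go to distinct
points, each edge goes to a curve that joins the images of its ends, is injective on the open
interval `(0, 1)` and meets no vertex there, and curves of distinct edges are disjoint away from
their end points. Values of `p` and `γ` outside the vertex and edge sets are irrelevant. -/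
structure IsEmbedding {X : Type*} [TopologicalSpace X] (G : Graph α β) (p : α → X)
    (γ : β → C(unitInterval, X)) : Prop where
  injOn_vertex : Set.InjOn p G.vertexSet
  ends : ∀ e x y, G.IsLink e x y → s(γ e 0, γ e 1) = s(p x, p y)
  injOn_curve : ∀ e ∈ G.edgeSet, Set.InjOn (γ e) (Set.Ioo 0 1)
  ne_vertex : ∀ e ∈ G.edgeSet, ∀ t ∈ Set.Ioo (0 : unitInterval) 1, ∀ x ∈ G.vertexSet, γ e t ≠ p x
  ne_curve : ∀ e ∈ G.edgeSet, ∀ f ∈ G.edgeSet, e ≠ f →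
    ∀ s ∈ Set.Ioo (0 : unitInterval) 1, ∀ t ∈ Set.Ioo (0 : unitInterval) 1, γ e s ≠ γ f t

/-- The torus `ℝ/ℤ × ℝ/ℤ`. -/
abbrev Torus : Type := UnitAddCircle × UnitAddCircle

/-- The graph embeds into the torus. -/
def IsToroidal (G : Graph α β) : Prop :=
  ∃ (p : α → Torus) (γ : β → C(unitInterval, Torus)), G.IsEmbedding p γ

/-- The map `(q, δ)` of `G.addChord e₁ x₁ y₁ e₂ x₂ y₂` agrees on `G` with the map `(p, γ)` of `G`:
same points for the vertices of `G`, same curves (as subsets of `X`) for the other edges of `G`,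
and the curve of a subdivided edge is the union of the curves of its two parts. -/
structure ExtendsToChord {X : Type*} [TopologicalSpace X] (G : Graph α β) (e₁ e₂ : β)
    (p : α → X) (γ : β → C(unitInterval, X))
    (q : α ⊕ Fin 2 → X) (δ : β ⊕ Fin 5 → C(unitInterval, X)) : Prop where
  vertex : ∀ x ∈ G.vertexSet, q (Sum.inl x) = p x
  edge : ∀ f ∈ G.edgeSet, f ≠ e₁ → f ≠ e₂ → Set.range (δ (Sum.inl f)) = Set.range (γ f)
  first : Set.range (δ (Sum.inr 0)) ∪ Set.range (δ (Sum.inr 1)) = Set.range (γ e₁)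
  second : Set.range (δ (Sum.inr 2)) ∪ Set.range (δ (Sum.inr 3)) = Set.range (γ e₂)

end Graph

/-! ### The graph `F₁₂` -/

/-- The twelve vertices of `F₁₂`. -/
inductive F12Vertex : Type
  | A | A' | B | B' | v1 | v2 | v3 | v4 | v5 | v6 | v7 | v8
  deriving DecidableEq

open F12Vertex in
/-- The cubic projective plane obstruction `F₁₂`, given by its eighteen edges. -/
def F12 : SimpleGraph F12Vertex :=
  SimpleGraph.fromEdgeSet
    {s(A, A'), s(A, v3), s(A', v2), s(B, B'), s(B, v6), s(B', v7), s(v2, v3), s(v6, v7),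
     s(A, v8), s(A', v5), s(B, v1), s(B', v4), s(v1, v2), s(v3, v4), s(v5, v6), s(v7, v8),
     s(v4, v5), s(v8, v1)}

/-- `F₁₂` as a multigraph; its edges are unordered pairs of vertices. -/
def F12Graph : Graph F12Vertex (Sym2 F12Vertex) := Graph.ofSimpleGraph F12

open F12Vertex in
/-- The fourteen pairs of edges `x₁y₁ - x₂y₂` of `F₁₂`, listed as `((x₁, y₁), (x₂, y₂))`. -/
def F12Case : Fin 14 → (F12Vertex × F12Vertex) × (F12Vertex × F12Vertex) :=
  ![((A, A'), (B, B')), ((A, A'), (B, v1)), ((A, A'), (B, v6)), ((A, A'), (v1, v2)),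
    ((A, A'), (v2, v3)), ((A, A'), (v4, v5)), ((A, A'), (v5, v6)), ((A, A'), (v6, v7)),
    ((A, v8), (A', v5)), ((A, v8), (B, v1)), ((A, v8), (B', v4)), ((A, v8), (v1, v2)),
    ((A, v8), (v4, v5)), ((v4, v5), (v8, v1))]

/-- `F₁₂ ∪ e`, where `e` joins a point of the edge `x₁y₁` to a point of the edge `x₂y₂`. -/
def F12Chord (x₁ y₁ x₂ y₂ : F12Vertex) :
    Graph (F12Vertex ⊕ Fin 2) (Sym2 F12Vertex ⊕ Fin 5) :=
  F12Graph.addChord s(x₁, y₁) x₁ y₁ s(x₂, y₂) x₂ y₂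

/-- Some automorphism of `F₁₂` carries the pair of edges `{x₁y₁, x₂y₂}` to the pair of edges of the
case `i`. -/
def F12SameCase (i : Fin 14) (x₁ y₁ x₂ y₂ : F12Vertex) : Prop :=
  ∃ σ : F12 ≃g F12,
    s(s(σ x₁, σ y₁), s(σ x₂, σ y₂)) =
      s(s((F12Case i).1.1, (F12Case i).1.2), s((F12Case i).2.1, (F12Case i).2.2))

/-!
Both drawings of `F₁₂` have straight edges and integral coordinates, so a comparison of
determinants decides whether edges and faces of a drawing are disjoint on the torus. If an edge is
the base of a triangle that is embedded off the drawing, and the midpoint of another edge is the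
third corner, then the altitude of the triangle is a chord between the two edges, while an arch and
a loop on a stem inside the triangle give the additions at the base alone. Two drawings provide
eighteen such triangles, and products of four involutive automorphisms of `F₁₂` carry every pair of
distinct edges to the pair of one of them.

A chord between edges with a common end makes a triangle, and a chord between disjoint edges of a
triangle-free simple graph does not. The fourteen pairs of disjoint edges are told apart by the
number of closed walks of length nine that are at an end of an edge of the pair at the times `0`
and `4`.
-/

/-! ### Arcs -/

namespace GraphDrawing

open Set Function unitInterval

variable {α β X : Type*} [TopologicalSpace X]

section Arc

variable {c : C(I, X)} {a b u v : X} {s t : I}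

/-- The points of a curve other than its two ends. -/
def openArc (c : C(I, X)) : Set X := c '' Ioo 0 1

/-- The curve `c` runs from `a` to `b` and is injective in between; a closed curve, with `a = b`, is
allowed. -/
structure IsArc (c : C(I, X)) (a b : X) : Prop where
  source : c 0 = a
  target : c 1 = b
  injOn : InjOn c (Ioo 0 1)

/-- The part of the curve `c` from the parameter `s` to the parameter `t`, which may be the smaller
one. -/
def subcurve (c : C(I, X)) (s t : I) : C(I, X) :=
  c.comp ⟨Icc.convexComb s t, by fun_prop⟩

lemma convexComb_injective (h : s ≠ t) : Injective (Icc.convexComb s t) := by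
  intro x y hxy
  have hst : (t : ℝ) - s ≠ 0 := sub_ne_zero.2 fun h' => h (Subtype.ext h'.symm)
  have hcoe : (1 - (x : ℝ)) * s + x * t = (1 - (y : ℝ)) * s + y * t := by
    simpa using congrArg Subtype.val hxy
  exact Subtype.ext (mul_right_cancel₀ hst (by linear_combination hcoe))

lemma image_convexComb_Ioo (h : s ≠ t) : Icc.convexComb s t '' Ioo 0 1 = uIoo s t := by
  have hIoo : (Ioo 0 1 : Set I) = univ \ {0, 1} := by
    rw [← Icc_sdiff_both, ← Icc_bot_top]; rfl
  rw [hIoo, image_sdiff (convexComb_injective h), image_univ, Path.range_subpathAux, image_pair,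
    Icc.convexComb_zero, Icc.convexComb_one]
  rcases h.lt_or_gt with h | h
  · rw [uIcc_of_lt h, uIoo_of_lt h, Icc_sdiff_both]
  · rw [uIcc_of_gt h, uIoo_of_gt h, pair_comm, Icc_sdiff_both]

lemma openArc_subcurve (h : s ≠ t) : openArc (subcurve c s t) = c '' uIoo s t := by
  rw [openArc, ← image_convexComb_Ioo h, image_image]
  rfl

lemma range_subcurve (c : C(I, X)) (s t : I) : range (subcurve c s t) = c '' uIcc s t := by
  rw [← Path.range_subpathAux, ← range_comp]
  rfl

lemma isArc_subcurve (hc : InjOn c (Ioo 0 1)) (h : s ≠ t) :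
    IsArc (subcurve c s t) (c s) (c t) := by
  refine ⟨by simp [subcurve], by simp [subcurve], ?_⟩
  refine hc.comp (convexComb_injective h).injOn (mapsTo_iff_image_subset.2 ?_)
  rw [ContinuousMap.coe_mk, image_convexComb_Ioo h]
  exact Ioo_subset_Ioo (le_inf s.2.1 t.2.1) (sup_le s.2.2 t.2.2)

lemma openArc_subcurve_one_zero (c : C(I, X)) : openArc (subcurve c 1 0) = openArc c := by
  rw [openArc_subcurve one_ne_zero, uIoo_of_gt zero_lt_one, openArc]

lemma range_subcurve_one_zero (c : C(I, X)) : range (subcurve c 1 0) = range c := by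
  rw [range_subcurve, uIcc_of_ge zero_le_one, ← image_univ, ← Icc_bot_top]
  rfl

lemma IsArc.reverse (h : IsArc c a b) : IsArc (subcurve c 1 0) b a := by
  simpa only [h.source, h.target] using isArc_subcurve h.injOn one_ne_zero

/-- The point `u` cuts the curve `c`, traversed from its end `a` to its end `b`, into the curves
`c₀` and `c₁`. -/
structure IsSplit (c : C(I, X)) (a u b : X) (c₀ c₁ : C(I, X)) : Prop where
  left : IsArc c₀ a u
  right : IsArc c₁ u b
  notMem_left : u ∉ openArc c₀
  notMem_right : u ∉ openArc c₁
  disjoint : Disjoint (openArc c₀) (openArc c₁)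
  openArc_union : openArc c₀ ∪ {u} ∪ openArc c₁ = openArc c
  range_union : range c₀ ∪ range c₁ = range c

lemma isSplit_subcurve (hc : IsArc c a b) (ht : t ∈ Ioo 0 1) :
    IsSplit c a (c t) b (subcurve c 0 t) (subcurve c t 1) := by
  obtain ⟨rfl, rfl, hinj⟩ := hc
  have hopen₀ : openArc (subcurve c 0 t) = c '' Ioo 0 t := by
    rw [openArc_subcurve ht.1.ne, uIoo_of_lt ht.1]
  have hopen₁ : openArc (subcurve c t 1) = c '' Ioo t 1 := by
    rw [openArc_subcurve ht.2.ne, uIoo_of_lt ht.2]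
  have hsub₀ : Ioo 0 t ⊆ Ioo 0 1 := Ioo_subset_Ioo_right ht.2.le
  have hsub₁ : Ioo t 1 ⊆ Ioo 0 1 := Ioo_subset_Ioo_left ht.1.le
  refine ⟨isArc_subcurve hinj ht.1.ne, isArc_subcurve hinj ht.2.ne, ?_, ?_, ?_, ?_, ?_⟩
  · simp [hopen₀, hinj.mem_image_iff hsub₀ ht]
  · simp [hopen₁, hinj.mem_image_iff hsub₁ ht]
  · rw [hopen₀, hopen₁]
    exact disjoint_image_image fun r hr r' hr' h =>
      (hr.2.trans hr'.1).ne (hinj (hsub₀ hr) (hsub₁ hr') h)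
  · rw [hopen₀, hopen₁, ← image_singleton, ← image_union, ← image_union,
      Ioo_union_right ht.1, Ioc_union_Ioo_eq_Ioo ht.1.le ht.2, openArc]
  · rw [range_subcurve, range_subcurve, uIcc_of_le ht.1.le, uIcc_of_le ht.2.le, ← image_union,
      Icc_union_Icc_eq_Icc ht.1.le ht.2.le, ← image_univ, ← Icc_bot_top]
    rfl

lemma exists_isSplit (hc : IsArc c a b) (hu : u ∈ openArc c) :
    ∃ c₀ c₁, IsSplit c a u b c₀ c₁ := by
  obtain ⟨t, ht, rfl⟩ := hu
  exact ⟨_, _, isSplit_subcurve hc ht⟩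

lemma exists_isSplit_mem_right (hc : IsArc c a b) (hu : u ∈ openArc c) (hv : v ∈ openArc c)
    (huv : u ≠ v) :
    (∃ c₀ c₁, IsSplit c a u b c₀ c₁ ∧ v ∈ openArc c₁) ∨
      ∃ c₀ c₁, IsSplit c a v b c₀ c₁ ∧ u ∈ openArc c₁ := by
  obtain ⟨s, hs, rfl⟩ := hu
  obtain ⟨t, ht, rfl⟩ := hv
  have mem_right {r r' : I} (hr : r < r') (hr' : r' < 1) : c r' ∈ openArc (subcurve c r 1) := by
    have hr₁ := hr.trans hr'
    rw [openArc_subcurve hr₁.ne, uIoo_of_lt hr₁]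
    exact mem_image_of_mem c ⟨hr, hr'⟩
  rcases lt_or_gt_of_ne fun hst : s = t => huv (congrArg c hst) with hst | hts
  · exact .inl ⟨_, _, isSplit_subcurve hc hs, mem_right hst ht.2⟩
  · exact .inr ⟨_, _, isSplit_subcurve hc ht, mem_right hts hs.2⟩

lemma IsSplit.congr {c' c₀ c₁ : C(I, X)} (h : IsSplit c a u b c₀ c₁)
    (harc : openArc c = openArc c') (hrange : range c = range c') :
    IsSplit c' a u b c₀ c₁ :=
  { h with
    openArc_union := h.openArc_union.trans harc
    range_union := h.range_union.trans hrange }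

lemma IsSplit.subset {c₀ c₁ : C(I, X)} (h : IsSplit c a u b c₀ c₁) :
    u ∈ openArc c ∧ openArc c₀ ⊆ openArc c ∧ openArc c₁ ⊆ openArc c := by
  rw [← h.openArc_union]
  exact ⟨by simp, by grind, by grind⟩

end Arc

/-! ### Drawings as families of disjoint cells -/

section Cells

variable {G : Graph α β} {p : α → X} {γ : β → C(I, X)} {D : Set β}

/-- The part of a drawing that belongs to a vertex or to an edge: a point or an open arc. -/
def cell (p : α → X) (γ : β → C(I, X)) : α ⊕ β → Set X :=
  Sum.elim (fun x => {p x}) fun e => openArc (γ e)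

/-- The vertices and the edges of a graph. -/
def cells (G : Graph α β) : Set (α ⊕ β) := Sum.inl '' G.vertexSet ∪ Sum.inr '' G.edgeSet

/-- The points off the drawing of the graph that is left when the edges in `D` are deleted. -/
def offDrawing (G : Graph α β) (p : α → X) (γ : β → C(I, X)) (D : Set β) : Set X :=
  {z | ∀ k ∈ cells G \ Sum.inr '' D, z ∉ cell p γ k}

lemma inl_mem_cells {x : α} : Sum.inl x ∈ cells G ↔ x ∈ G.vertexSet := by simp [cells]

lemma inr_mem_cells {e : β} : Sum.inr e ∈ cells G ↔ e ∈ G.edgeSet := by simp [cells]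

lemma isEmbedding_iff : G.IsEmbedding p γ ↔
    (cells G).PairwiseDisjoint (cell p γ) ∧
      (∀ e x y, G.IsLink e x y → s(γ e 0, γ e 1) = s(p x, p y)) ∧
      ∀ e ∈ G.edgeSet, InjOn (γ e) (Ioo 0 1) := by
  constructor
  · intro h
    refine ⟨?_, h.ends, h.injOn_curve⟩
    rintro (x | e) hx (y | f) hy hne <;>
      simp only [inl_mem_cells, inr_mem_cells] at hx hy <;>
      simp only [onFun, cell, Sum.elim_inl, Sum.elim_inr, disjoint_singleton_left,
        disjoint_singleton_right, openArc, mem_singleton_iff]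
    · exact fun hxy => hne (congrArg _ (h.injOn_vertex hx hy hxy.symm))
    · rintro ⟨t, ht, htx⟩
      exact h.ne_vertex f hy t ht x hx htx
    · rintro ⟨t, ht, htx⟩
      exact h.ne_vertex e hx t ht y hy htx
    · exact disjoint_image_image fun s hs t ht =>
        h.ne_curve e hx f hy (fun hef => hne (congrArg _ hef)) s hs t ht
  · rintro ⟨hdisj, hends, hinj⟩
    refine ⟨fun x hx y hy hxy => ?_, hends, hinj, fun e he t ht x hx htx => ?_,
      fun e he f hf hne s hs t ht hst => ?_⟩
    · exact Sum.inl_injective <| hdisj.elim_set (inl_mem_cells.2 hx) (inl_mem_cells.2 hy) (p x)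
        rfl hxy
    · exact Sum.inr_ne_inl <| hdisj.elim_set (inr_mem_cells.2 he) (inl_mem_cells.2 hx) _
        (mem_image_of_mem _ ht) htx
    · exact hne <| Sum.inr_injective <| hdisj.elim_set (inr_mem_cells.2 he) (inr_mem_cells.2 hf) _
        (mem_image_of_mem _ hs) (hst ▸ mem_image_of_mem _ ht)

lemma offDrawing_mono {D' : Set β} (h : D ⊆ D') : offDrawing G p γ D ⊆ offDrawing G p γ D' :=
  fun _ hz k hk => hz k ⟨hk.1, fun hkD => hk.2 (image_mono h hkD)⟩

lemma openArc_subset_offDrawing (h : G.IsEmbedding p γ) {e : β} (he : e ∈ G.edgeSet)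
    (heD : e ∈ D) : openArc (γ e) ⊆ offDrawing G p γ D := fun z hz _ hk hzk =>
  hk.2 ⟨e, heD, (isEmbedding_iff.1 h).1.elim_set (inr_mem_cells.2 he) hk.1 z hz hzk⟩

lemma disjoint_openArc_offDrawing {e : β} (he : e ∈ G.edgeSet) :
    Disjoint (openArc (γ e)) (offDrawing G p γ ∅) :=
  Set.disjoint_left.2 fun _ hz hz' => hz' (Sum.inr e) ⟨inr_mem_cells.2 he, by simp⟩ hz

lemma disjoint_openArc (h : G.IsEmbedding p γ) {e f : β} (he : e ∈ G.edgeSet) (hf : f ∈ G.edgeSet)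
    (hef : e ≠ f) : Disjoint (openArc (γ e)) (openArc (γ f)) :=
  (isEmbedding_iff.1 h).1 (inr_mem_cells.2 he) (inr_mem_cells.2 hf) (Sum.inr_injective.ne hef)

lemma exists_isArc (h : G.IsEmbedding p γ) {e : β} {x y : α} (hl : G.IsLink e x y) :
    ∃ c, IsArc c (p x) (p y) ∧ openArc c = openArc (γ e) ∧ range c = range (γ e) := by
  have hinj := h.injOn_curve e hl.edge_mem
  rcases Sym2.eq_iff.1 (h.ends e x y hl) with ⟨h₀, h₁⟩ | ⟨h₀, h₁⟩
  · exact ⟨γ e, ⟨h₀, h₁, hinj⟩, rfl, rfl⟩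
  · exact ⟨subcurve (γ e) 1 0, IsArc.reverse ⟨h₀, h₁, hinj⟩, openArc_subcurve_one_zero _,
      range_subcurve_one_zero _⟩

lemma exists_isSplit_edge (h : G.IsEmbedding p γ) {e : β} {x y : α} (hl : G.IsLink e x y) {u : X}
    (hu : u ∈ openArc (γ e)) : ∃ c₀ c₁, IsSplit (γ e) (p x) u (p y) c₀ c₁ := by
  obtain ⟨c, hc, harc, hrange⟩ := exists_isArc h hl
  obtain ⟨c₀, c₁, hsplit⟩ := exists_isSplit hc (harc ▸ hu)
  exact ⟨c₀, c₁, hsplit.congr harc hrange⟩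

section ReplaceEdges

variable {n : ℕ} {new : Fin n → Sym2 (α ⊕ Fin 2)} {w : Fin 2 → X} {c : Fin n → C(I, X)}

lemma cell_sumElim (k : (α ⊕ Fin 2) ⊕ (β ⊕ Fin n)) :
    cell (Sum.elim p w) (Sum.elim γ c) k =
      Sum.elim (cell p γ) (cell w c) (Equiv.sumSumSumComm α (Fin 2) β (Fin n) k) := by
  rcases k with (x | i) | (e | i) <;> rfl

lemma mem_cells_of_mem_cells_replaceEdges {k : (α ⊕ Fin 2) ⊕ (β ⊕ Fin n)}
    (hk : k ∈ cells (G.replaceEdges D new)) {k₀ : α ⊕ β}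
    (h : Equiv.sumSumSumComm α (Fin 2) β (Fin n) k = Sum.inl k₀) :
    k₀ ∈ cells G \ Sum.inr '' D := by
  obtain rfl := (Equiv.eq_symm_apply _).2 h
  rcases k₀ with x | e
  · obtain ⟨x', hx', hxx'⟩ | ⟨i, hi⟩ := inl_mem_cells.1 hk
    · obtain rfl := Sum.inl_injective hxx'
      exact ⟨inl_mem_cells.2 hx', by simp⟩
    · exact absurd hi Sum.inr_ne_inl
  · obtain ⟨x, y, heD, a, b, hab, -⟩ :=
      ((G.replaceEdges D new).edge_mem_iff_exists_isLink _).1 (inr_mem_cells.1 hk)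
    exact ⟨inr_mem_cells.2 hab.edge_mem, by simpa using heD⟩

theorem isEmbedding_replaceEdges (h : G.IsEmbedding p γ)
    (hends : ∀ i, s(c i 0, c i 1) = (new i).map (Sum.elim p w))
    (hinj : ∀ i, InjOn (c i) (Ioo 0 1)) (hoff : ∀ k, cell w c k ⊆ offDrawing G p γ D)
    (hdisj : Pairwise (Disjoint on cell w c)) :
    (G.replaceEdges D new).IsEmbedding (Sum.elim p w) (Sum.elim γ c) := by
  have hold_new {k₀ : α ⊕ β} (hk₀ : k₀ ∈ cells G \ Sum.inr '' D) (k : Fin 2 ⊕ Fin n) :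
      Disjoint (cell p γ k₀) (cell w c k) :=
    Set.disjoint_left.2 fun z hz hz' => hoff k hz' k₀ hk₀ hz
  refine isEmbedding_iff.2 ⟨fun k hk k' hk' hne => ?_, ?_, ?_⟩
  · have hne' := (Equiv.sumSumSumComm α (Fin 2) β (Fin n)).injective.ne hne
    simp only [onFun, cell_sumElim]
    rcases hφ : Equiv.sumSumSumComm α (Fin 2) β (Fin n) k with k₀ | k₁ <;>
      rcases hφ' : Equiv.sumSumSumComm α (Fin 2) β (Fin n) k' with k₀' | k₁'
    · exact (isEmbedding_iff.1 h).1 (mem_cells_of_mem_cells_replaceEdges hk hφ).1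
        (mem_cells_of_mem_cells_replaceEdges hk' hφ').1 fun hkk' => hne' (by rw [hφ, hφ', hkk'])
    · exact hold_new (mem_cells_of_mem_cells_replaceEdges hk hφ) k₁'
    · exact (hold_new (mem_cells_of_mem_cells_replaceEdges hk' hφ') k₁).symm
    · exact hdisj fun hkk' => hne' (by rw [hφ, hφ', hkk'])
  · rintro (e | i) x y hl
    · obtain ⟨-, a, b, hab, rfl, rfl⟩ := hl
      exact h.ends e a b hab
    · exact (hends i).trans (by rw [hl.1, Sym2.map_mk])
  · rintro (e | i) he
    · exact h.injOn_curve e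
        (inr_mem_cells.1 (mem_cells_of_mem_cells_replaceEdges (inr_mem_cells.2 he) rfl).1)
    · exact hinj i

end ReplaceEdges

end Cells

end GraphDrawing

/-! ### One-edge additions to a drawing -/

namespace GraphDrawing

open Set Function unitInterval

lemma pairwise_disjoint_of_refines {ι κ X : Type*} {A : ι → Set X} {B : κ → Set X} (host : ι → κ)
    (hB : Pairwise (Disjoint on B)) (hsub : ∀ i, A i ⊆ B (host i))
    (hfiber : ∀ i j, i ≠ j → host i = host j → Disjoint (A i) (A j)) :
    Pairwise (Disjoint on A) := fun i j hij =>
  (eq_or_ne (host i) (host j)).elim (hfiber i j hij) fun h => (hB h).mono (hsub i) (hsub j)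

variable {α β X : Type*} [TopologicalSpace X] {G : Graph α β} {p : α → X} {γ : β → C(I, X)}
  {e f : β} {x y x' y' : α} {u v : X} {χ ω : C(I, X)}

theorem exists_extendsToChord (h : G.IsEmbedding p γ) (he : G.IsLink e x y)
    (hf : G.IsLink f x' y') (hef : e ≠ f) (hχ : IsArc χ u v) (hu : u ∈ openArc (γ e))
    (hv : v ∈ openArc (γ f)) (hoff : openArc χ ⊆ offDrawing G p γ ∅) :
    ∃ q δ, (G.addChord e x y f x' y').IsEmbedding q δ ∧ G.ExtendsToChord e f p γ q δ := by
  obtain ⟨a, a', ha⟩ := exists_isSplit_edge h he hu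
  obtain ⟨b, b', hb⟩ := exists_isSplit_edge h hf hv
  let host : Fin 2 ⊕ Fin 5 → Fin 3 := Sum.elim ![0, 1] ![0, 0, 1, 1, 2]
  let hosts : Fin 3 → Set X := ![openArc (γ e), openArc (γ f), openArc χ]
  have hhosts : Pairwise (Disjoint on hosts) := by
    rw [pairwise_disjoint_on]
    have := disjoint_openArc h he.edge_mem hf.edge_mem hef
    have := (disjoint_openArc_offDrawing he.edge_mem).mono_right hoff
    have := (disjoint_openArc_offDrawing hf.edge_mem).mono_right hoff
    intro i j hij
    fin_cases i <;> fin_cases j <;> first | exact absurd hij (by decide) | assumption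
  have hhosts_off : ∀ i, hosts i ⊆ offDrawing G p γ {e, f} := by
    intro i
    fin_cases i
    exacts [openArc_subset_offDrawing h he.edge_mem (by simp),
      openArc_subset_offDrawing h hf.edge_mem (by simp), hoff.trans (offDrawing_mono (by simp))]
  have hsub : ∀ k, cell ![u, v] ![a, a', b, b', χ] k ⊆ hosts (host k) := by
    rintro (i | i) <;> fin_cases i <;>
      simp [cell, host, hosts, hu, hv, ha.subset, hb.subset]
  refine ⟨Sum.elim p ![u, v], Sum.elim γ ![a, a', b, b', χ],
    isEmbedding_replaceEdges h ?_ ?_ (fun k => (hsub k).trans (hhosts_off _))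
      (pairwise_disjoint_of_refines host hhosts hsub ?_),
    ⟨fun _ _ => rfl, fun _ _ _ _ => rfl, ha.range_union, hb.range_union⟩⟩
  · intro i
    fin_cases i <;>
      simp [ha.left.source, ha.left.target, ha.right.source, ha.right.target, hb.left.source,
        hb.left.target, hb.right.source, hb.right.target, hχ.source, hχ.target]
  · intro i
    fin_cases i
    exacts [ha.left.injOn, ha.right.injOn, hb.left.injOn, hb.right.injOn, hχ.injOn]
  · rintro (i | i) (j | j) hij hhost <;> fin_cases i <;> fin_cases j <;>
      simp [host, cell, ha.disjoint, ha.disjoint.symm, hb.disjoint, hb.disjoint.symm,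
        ha.notMem_left, ha.notMem_right, hb.notMem_left, hb.notMem_right] at hij hhost ⊢

theorem exists_isEmbedding_addLoop (h : G.IsEmbedding p γ) (he : G.IsLink e x y)
    (hχ : IsArc χ u v) (hω : IsArc ω v v) (hu : u ∈ openArc (γ e))
    (hoff : {v} ∪ openArc χ ∪ openArc ω ⊆ offDrawing G p γ ∅) (hvχ : v ∉ openArc χ)
    (hvω : v ∉ openArc ω) (hχω : Disjoint (openArc χ) (openArc ω)) :
    ∃ q δ, (G.addLoop e x y).IsEmbedding (X := X) q δ := by
  obtain ⟨a, a', ha⟩ := exists_isSplit_edge h he hu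
  let host : Fin 2 ⊕ Fin 4 → Fin 4 := Sum.elim ![0, 1] ![0, 0, 2, 3]
  let hosts : Fin 4 → Set X := ![openArc (γ e), {v}, openArc χ, openArc ω]
  simp only [union_subset_iff] at hoff
  have hhosts : Pairwise (Disjoint on hosts) := by
    rw [pairwise_disjoint_on]
    have hdisj := disjoint_openArc_offDrawing (p := p) (γ := γ) he.edge_mem
    intro i j hij
    fin_cases i <;> fin_cases j <;> first
      | exact absurd hij (by decide)
      | simp [hosts, hdisj.mono_right hoff.1.1, hdisj.mono_right hoff.1.2,
          hdisj.mono_right hoff.2, hvχ, hvω, hχω, -disjoint_singleton_right]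
  have hhosts_off : ∀ i, hosts i ⊆ offDrawing G p γ {e} := by
    have hmono : offDrawing G p γ ∅ ⊆ offDrawing G p γ {e} := offDrawing_mono (by simp)
    intro i
    fin_cases i
    exacts [openArc_subset_offDrawing h he.edge_mem rfl, hoff.1.1.trans hmono,
      hoff.1.2.trans hmono, hoff.2.trans hmono]
  have hsub : ∀ k, cell ![u, v] ![a, a', χ, ω] k ⊆ hosts (host k) := by
    rintro (i | i) <;> fin_cases i <;> simp [cell, host, hosts, hu, ha.subset]
  refine ⟨Sum.elim p ![u, v], Sum.elim γ ![a, a', χ, ω],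
    isEmbedding_replaceEdges h ?_ ?_ (fun k => (hsub k).trans (hhosts_off _))
      (pairwise_disjoint_of_refines host hhosts hsub ?_)⟩
  · intro i
    fin_cases i <;>
      simp [ha.left.source, ha.left.target, ha.right.source, ha.right.target, hχ.source,
        hχ.target, hω.source, hω.target]
  · intro i
    fin_cases i
    exacts [ha.left.injOn, ha.right.injOn, hχ.injOn, hω.injOn]
  · rintro (i | i) (j | j) hij hhost <;> fin_cases i <;> fin_cases j <;>
      simp [host, cell, ha.disjoint, ha.disjoint.symm, ha.notMem_left, ha.notMem_right]
        at hij hhost ⊢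

lemma exists_isEmbedding_addParallel_of_isSplit (h : G.IsEmbedding p γ) (he : G.IsLink e x y)
    {c₀ c₁₂ c₁ c₂ : C(I, X)} (hsplit : IsSplit (γ e) (p x) u (p y) c₀ c₁₂)
    (hsplit' : IsSplit c₁₂ u v (p y) c₁ c₂) (hχ : s(χ 0, χ 1) = s(u, v))
    (hχinj : InjOn χ (Ioo 0 1)) (hoff : openArc χ ⊆ offDrawing G p γ ∅) :
    ∃ q δ, (G.addParallel e x y).IsEmbedding (X := X) q δ := by
  let host : Fin 2 ⊕ Fin 4 → Fin 4 := Sum.elim ![0, 2] ![1, 2, 2, 3]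
  let hosts : Fin 4 → Set X := ![{u}, openArc c₀, openArc c₁₂, openArc χ]
  have hdisj := (disjoint_openArc_offDrawing he.edge_mem).mono_right hoff
  have hhosts : Pairwise (Disjoint on hosts) := by
    rw [pairwise_disjoint_on]
    intro i j hij
    fin_cases i <;> fin_cases j <;> first
      | exact absurd hij (by decide)
      | simp [hosts, hsplit.disjoint, hsplit.notMem_left, hsplit.notMem_right,
          hdisj.mono_left hsplit.subset.2.1, hdisj.mono_left hsplit.subset.2.2,
          disjoint_left.1 hdisj hsplit.subset.1]
  have hhosts_off : ∀ i, hosts i ⊆ offDrawing G p γ {e} := by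
    have hedge := openArc_subset_offDrawing h he.edge_mem (mem_singleton e)
    intro i
    fin_cases i
    exacts [singleton_subset_iff.2 (hedge hsplit.subset.1), hsplit.subset.2.1.trans hedge,
      hsplit.subset.2.2.trans hedge, hoff.trans (offDrawing_mono (by simp))]
  have hsub : ∀ k, cell ![u, v] ![c₀, c₁, c₂, χ] k ⊆ hosts (host k) := by
    rintro (i | i) <;> fin_cases i <;> simp [cell, host, hosts, hsplit'.subset]
  refine ⟨Sum.elim p ![u, v], Sum.elim γ ![c₀, c₁, c₂, χ],
    isEmbedding_replaceEdges h ?_ ?_ (fun k => (hsub k).trans (hhosts_off _))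
      (pairwise_disjoint_of_refines host hhosts hsub ?_)⟩
  · intro i
    fin_cases i <;>
      simp [hsplit.left.source, hsplit.left.target, hsplit'.left.source, hsplit'.left.target,
        hsplit'.right.source, hsplit'.right.target, hχ]
  · intro i
    fin_cases i
    exacts [hsplit.left.injOn, hsplit'.left.injOn, hsplit'.right.injOn, hχinj]
  · rintro (i | i) (j | j) hij hhost <;> fin_cases i <;> fin_cases j <;>
      simp [host, cell, hsplit'.disjoint, hsplit'.disjoint.symm, hsplit'.notMem_left,
        hsplit'.notMem_right] at hij hhost ⊢

theorem exists_isEmbedding_addParallel (h : G.IsEmbedding p γ) (he : G.IsLink e x y)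
    (hχ : IsArc χ u v) (hu : u ∈ openArc (γ e)) (hv : v ∈ openArc (γ e)) (huv : u ≠ v)
    (hoff : openArc χ ⊆ offDrawing G p γ ∅) :
    ∃ q δ, (G.addParallel e x y).IsEmbedding (X := X) q δ := by
  obtain ⟨c, hc, harc, hrange⟩ := exists_isArc h he
  have hends : s(χ 0, χ 1) = s(u, v) := by rw [hχ.source, hχ.target]
  rcases exists_isSplit_mem_right hc (harc ▸ hu) (harc ▸ hv) huv with
    ⟨c₀, c₁₂, hsplit, hv'⟩ | ⟨c₀, c₁₂, hsplit, hu'⟩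
  · obtain ⟨c₁, c₂, hsplit'⟩ := exists_isSplit hsplit.right hv'
    exact exists_isEmbedding_addParallel_of_isSplit h he (hsplit.congr harc hrange) hsplit' hends
      hχ.injOn hoff
  · obtain ⟨c₁, c₂, hsplit'⟩ := exists_isSplit hsplit.right hu'
    exact exists_isEmbedding_addParallel_of_isSplit h he (hsplit.congr harc hrange) hsplit'
      (hends.trans Sym2.eq_swap) hχ.injOn hoff

end GraphDrawing

/-! ### Ears -/

namespace GraphDrawing

open Set Function unitInterval

section Restrict

variable {X : Type*} [TopologicalSpace X] (c : C(ℝ, X))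

lemma openArc_restrict : openArc (c.restrict I) = c '' Ioo 0 1 := by
  ext z
  constructor
  · rintro ⟨t, ht, rfl⟩
    exact ⟨t, ht, rfl⟩
  · rintro ⟨t, ht, rfl⟩
    exact ⟨⟨t, ht.1.le, ht.2.le⟩, ht, rfl⟩

variable {c}

lemma isArc_restrict (hc : InjOn c (Ioo 0 1)) : IsArc (c.restrict I) (c 0) (c 1) :=
  ⟨rfl, rfl, fun _ hs _ ht hst => Subtype.ext (hc hs ht hst)⟩

end Restrict

/-- The open triangle with corners `(-1/2, 0)`, `(1/2, 0)` and `(0, 1)`. -/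
def earRegion : Set (ℝ × ℝ) := {w | 0 < w.2 ∧ |w.1| < (1 - w.2) / 2}

/-- The altitude of the triangle `earRegion`, from the midpoint of the base to the apex. -/
def earAltitude : C(ℝ, ℝ × ℝ) := ⟨fun r => (0, r), by fun_prop⟩

/-- An arch in the triangle `earRegion` that joins two points of the base. -/
noncomputable def earArch : C(ℝ, ℝ × ℝ) := ⟨fun r => (r / 2 - 1 / 4, r * (1 - r)), by fun_prop⟩

/-- The lower quarter of the altitude of the triangle `earRegion`. -/
noncomputable def earStem : C(ℝ, ℝ × ℝ) := ⟨fun r => (0, r / 4), by fun_prop⟩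

/-- A closed curve in the triangle `earRegion` through the end `(0, 1/4)` of `earStem`. -/
noncomputable def earLoop : C(ℝ, ℝ × ℝ) :=
  ⟨fun r => (r * (1 - r) * (1 - 2 * r) / 2, 1 / 4 + r * (1 - r)), by fun_prop⟩

lemma mapsTo_earAltitude : MapsTo earAltitude (Ioo 0 1) earRegion := fun r hr =>
  ⟨hr.1, by simpa [earAltitude] using hr.2⟩

lemma injective_earAltitude : Injective earAltitude := fun _ _ h => congrArg Prod.snd h

lemma mapsTo_earArch : MapsTo earArch (Ioo 0 1) earRegion := by
  rintro r ⟨h₀, h₁⟩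
  exact ⟨mul_pos h₀ (sub_pos.2 h₁), abs_lt.2
    ⟨by simp only [earArch, ContinuousMap.coe_mk]; nlinarith,
      by simp only [earArch, ContinuousMap.coe_mk]; nlinarith⟩⟩

lemma injective_earArch : Injective earArch := fun r s h => by
  have : r / 2 - 1 / 4 = s / 2 - 1 / 4 := congrArg Prod.fst h
  linarith

lemma mapsTo_earStem : MapsTo earStem (Ioo 0 1) earRegion := by
  rintro r ⟨h₀, h₁⟩
  refine ⟨by simpa [earStem] using h₀, ?_⟩
  simp only [earStem, ContinuousMap.coe_mk, abs_zero]
  linarith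

lemma injective_earStem : Injective earStem := fun r s h => by
  have : r / 4 = s / 4 := congrArg Prod.snd h
  linarith

lemma mapsTo_earLoop : MapsTo earLoop (Ioo 0 1) earRegion := by
  rintro r ⟨h₀, h₁⟩
  have hpos : 0 < r * (1 - r) := mul_pos h₀ (sub_pos.2 h₁)
  have hle : r * (1 - r) ≤ 1 / 4 := by nlinarith [sq_nonneg (1 - 2 * r)]
  refine ⟨by simp only [earLoop, ContinuousMap.coe_mk]; positivity, abs_lt.2 ?_⟩
  constructor <;> simp only [earLoop, ContinuousMap.coe_mk] <;> nlinarith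

lemma injOn_earLoop : InjOn earLoop (Ioo 0 1) := by
  rintro r ⟨h₀, h₁⟩ s - h
  have hfst : r * (1 - r) * (1 - 2 * r) / 2 = s * (1 - s) * (1 - 2 * s) / 2 :=
    congrArg Prod.fst h
  have hsnd : 1 / 4 + r * (1 - r) = 1 / 4 + s * (1 - s) := congrArg Prod.snd h
  have hpos : 0 < r * (1 - r) := mul_pos h₀ (sub_pos.2 h₁)
  have hmul : r * (1 - r) * (1 - 2 * r) = r * (1 - r) * (1 - 2 * s) := by
    linear_combination 2 * hfst - (1 - 2 * s) * hsnd
  linarith [mul_left_cancel₀ hpos.ne' hmul]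

variable {α β X : Type*} [TopologicalSpace X] {G : Graph α β} {p : α → X} {γ : β → C(I, X)}
  {e f : β} {x y x' y' : α} {z : C(ℝ × ℝ, X)}

/-- The map `z` draws the triangle `earRegion` off the drawing of `G`, with its base inside the edge
`e`, so that new vertices and edges that are attached to `e` can be drawn in the triangle. -/
structure IsEar (G : Graph α β) (p : α → X) (γ : β → C(I, X)) (e : β) (z : C(ℝ × ℝ, X)) :
    Prop where
  injOn : InjOn z earRegion
  mapsTo : MapsTo z earRegion (offDrawing G p γ ∅)
  base : ∀ r ∈ Ioo (-(1 / 2) : ℝ) (1 / 2), z (r, 0) ∈ openArc (γ e)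
  base_injOn : InjOn (fun r => z (r, 0)) (Ioo (-(1 / 2)) (1 / 2))

/-- Points inside the edges `e` and `f` can be joined by an arc off the drawing. -/
def IsJoinable (G : Graph α β) (p : α → X) (γ : β → C(I, X)) (e f : β) : Prop :=
  ∃ u ∈ openArc (γ e), ∃ v ∈ openArc (γ f), ∃ χ, IsArc χ u v ∧ openArc χ ⊆ offDrawing G p γ ∅

namespace IsJoinable

lemma symm (h : IsJoinable G p γ e f) : IsJoinable G p γ f e := by
  obtain ⟨u, hu, v, hv, χ, hχ, hoff⟩ := h
  exact ⟨v, hv, u, hu, _, hχ.reverse, (openArc_subcurve_one_zero χ).trans_subset hoff⟩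

theorem exists_extendsToChord (h : IsJoinable G p γ e f) (hG : G.IsEmbedding p γ)
    (he : G.IsLink e x y) (hf : G.IsLink f x' y') (hef : e ≠ f) :
    ∃ q δ, (G.addChord e x y f x' y').IsEmbedding q δ ∧ G.ExtendsToChord e f p γ q δ := by
  obtain ⟨u, hu, v, hv, χ, hχ, hoff⟩ := h
  exact GraphDrawing.exists_extendsToChord hG he hf hef hχ hu hv hoff

end IsJoinable

namespace IsEar

lemma isArc (h : IsEar G p γ e z) {g : C(ℝ, ℝ × ℝ)} (hg : MapsTo g (Ioo 0 1) earRegion)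
    (hinj : InjOn g (Ioo 0 1)) : IsArc ((z.comp g).restrict I) (z (g 0)) (z (g 1)) :=
  isArc_restrict (h.injOn.comp hinj hg)

lemma openArc_subset (h : IsEar G p γ e z) {g : C(ℝ, ℝ × ℝ)}
    (hg : MapsTo g (Ioo 0 1) earRegion) :
    openArc ((z.comp g).restrict I) ⊆ offDrawing G p γ ∅ := by
  rw [openArc_restrict]
  exact (h.mapsTo.comp hg).image_subset

lemma isJoinable (h : IsEar G p γ e z) (hapex : z (0, 1) ∈ openArc (γ f)) :
    IsJoinable G p γ e f :=
  ⟨_, h.base 0 (by norm_num), _, hapex, _,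
    h.isArc mapsTo_earAltitude injective_earAltitude.injOn, h.openArc_subset mapsTo_earAltitude⟩

theorem exists_isEmbedding_addParallel (h : IsEar G p γ e z) (hG : G.IsEmbedding p γ)
    (he : G.IsLink e x y) : ∃ q δ, (G.addParallel e x y).IsEmbedding (X := X) q δ := by
  have h₀ : earArch 0 = (-(1 / 4), 0) := by ext <;> norm_num [earArch]
  have h₁ : earArch 1 = (1 / 4, 0) := by ext <;> norm_num [earArch]
  refine GraphDrawing.exists_isEmbedding_addParallel hG he
    (h.isArc mapsTo_earArch injective_earArch.injOn) ?_ ?_ ?_ (h.openArc_subset mapsTo_earArch)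
  · exact h₀ ▸ h.base _ (by norm_num)
  · exact h₁ ▸ h.base _ (by norm_num)
  · rw [h₀, h₁]
    refine h.base_injOn.ne ?_ ?_ ?_ <;> norm_num

theorem exists_isEmbedding_addLoop (h : IsEar G p γ e z) (hG : G.IsEmbedding p γ)
    (he : G.IsLink e x y) : ∃ q δ, (G.addLoop e x y).IsEmbedding (X := X) q δ := by
  have hroot : ((0, 1 / 4) : ℝ × ℝ) ∈ earRegion := by norm_num [earRegion]
  have hstem₀ : earStem 0 = (0, 0) := by simp [earStem]
  have hstem₁ : earStem 1 = (0, 1 / 4) := by simp [earStem]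
  have hloop₀ : earLoop 0 = (0, 1 / 4) := by simp [earLoop]
  have hloop₁ : earLoop 1 = (0, 1 / 4) := by simp [earLoop]
  have hstem := h.isArc mapsTo_earStem injective_earStem.injOn
  have hloop := h.isArc mapsTo_earLoop injOn_earLoop
  rw [hstem₀, hstem₁] at hstem
  rw [hloop₀, hloop₁] at hloop
  have stem_lt {r : ℝ} (hr : r ∈ Ioo 0 1) : (earStem r).2 < 1 / 4 := by
    simp only [earStem, ContinuousMap.coe_mk]
    linarith [hr.2]
  have lt_loop {r : ℝ} (hr : r ∈ Ioo 0 1) : 1 / 4 < (earLoop r).2 := by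
    simpa [earLoop] using mul_pos hr.1 (sub_pos.2 hr.2)
  refine GraphDrawing.exists_isEmbedding_addLoop hG he hstem hloop (h.base 0 (by norm_num))
    (union_subset (union_subset (singleton_subset_iff.2 (h.mapsTo hroot))
      (h.openArc_subset mapsTo_earStem)) (h.openArc_subset mapsTo_earLoop)) ?_ ?_ ?_ <;>
    simp only [openArc_restrict]
  · rintro ⟨r, hr, hrz⟩
    exact (stem_lt hr).ne (congrArg Prod.snd (h.injOn (mapsTo_earStem hr) hroot hrz))
  · rintro ⟨r, hr, hrz⟩
    exact (lt_loop hr).ne' (congrArg Prod.snd (h.injOn (mapsTo_earLoop hr) hroot hrz))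
  · refine Set.disjoint_left.2 ?_
    rintro _ ⟨r, hr, rfl⟩ ⟨s, hs, hsr⟩
    exact ((stem_lt hr).trans (lt_loop hs)).ne'
      (congrArg Prod.snd (h.injOn (mapsTo_earLoop hs) (mapsTo_earStem hr) hsr))

end IsEar

section Pullback

variable {α' β' : Type*} {G' : Graph α' β'} {φ : α' → α} {ψ : β' → β}

lemma mem_cells_map (hV : MapsTo φ G'.vertexSet G.vertexSet)
    (hE : MapsTo ψ G'.edgeSet G.edgeSet) {k : α' ⊕ β'} (hk : k ∈ cells G') :
    k.map φ ψ ∈ cells G := by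
  obtain ⟨x, hx, rfl⟩ | ⟨e, he, rfl⟩ := hk
  · exact inl_mem_cells.2 (hV hx)
  · exact inr_mem_cells.2 (hE he)

lemma cell_comp (k : α' ⊕ β') : cell (p ∘ φ) (γ ∘ ψ) k = cell p γ (k.map φ ψ) := by
  cases k <;> rfl

lemma isEmbedding_comp (h : G.IsEmbedding p γ) (hφ : Injective φ) (hψ : Injective ψ)
    (hV : MapsTo φ G'.vertexSet G.vertexSet)
    (hlink : ∀ e x y, G'.IsLink e x y → G.IsLink (ψ e) (φ x) (φ y)) :
    G'.IsEmbedding (p ∘ φ) (γ ∘ ψ) := by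
  have hE : MapsTo ψ G'.edgeSet G.edgeSet := fun e he => by
    obtain ⟨x, y, hxy⟩ := (G'.edge_mem_iff_exists_isLink e).1 he
    exact (hlink e x y hxy).edge_mem
  obtain ⟨hdisj, hends, hinj⟩ := isEmbedding_iff.1 h
  refine isEmbedding_iff.2 ⟨fun k hk l hl hkl => ?_,
    fun e x y hxy => hends _ _ _ (hlink e x y hxy), fun e he => hinj _ (hE he)⟩
  simp only [onFun, cell_comp]
  exact hdisj (mem_cells_map hV hE hk) (mem_cells_map hV hE hl)
    ((Sum.map_injective.2 ⟨hφ, hψ⟩).ne hkl)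

lemma offDrawing_subset_comp (hV : MapsTo φ G'.vertexSet G.vertexSet)
    (hE : MapsTo ψ G'.edgeSet G.edgeSet) :
    offDrawing G p γ ∅ ⊆ offDrawing G' (p ∘ φ) (γ ∘ ψ) ∅ := fun _ hw k hk =>
  cell_comp (p := p) (γ := γ) k ▸ hw _ ⟨mem_cells_map hV hE hk.1, by simp⟩

lemma IsEar.comp {e : β'} (h : IsEar G p γ (ψ e) z) (hV : MapsTo φ G'.vertexSet G.vertexSet)
    (hE : MapsTo ψ G'.edgeSet G.edgeSet) : IsEar G' (p ∘ φ) (γ ∘ ψ) e z :=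
  ⟨h.injOn, h.mapsTo.mono_right (offDrawing_subset_comp hV hE), h.base, h.base_injOn⟩

lemma IsJoinable.comp {e f : β'} (h : IsJoinable G p γ (ψ e) (ψ f))
    (hV : MapsTo φ G'.vertexSet G.vertexSet) (hE : MapsTo ψ G'.edgeSet G.edgeSet) :
    IsJoinable G' (p ∘ φ) (γ ∘ ψ) e f := by
  obtain ⟨u, hu, v, hv, χ, hχ, hoff⟩ := h
  exact ⟨u, hu, v, hv, χ, hχ, hoff.trans (offDrawing_subset_comp hV hE)⟩

end Pullback

end GraphDrawing

/-! ### Separation of polygons on the torus -/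

namespace GraphDrawing

open Set Function

section OpenHull

variable {ι κ E : Type*} [Fintype ι] [Fintype κ] [AddCommGroup E] [Module ℝ E] {T : ι → E}
  {S : κ → E}

/-- The convex combinations of the points `T i` in which all weights are positive: the relative
interior of their convex hull. -/
def openHull (T : ι → E) : Set E :=
  {z | ∃ u : ι → ℝ, (∀ i, 0 < u i) ∧ ∑ i, u i = 1 ∧ ∑ i, u i • T i = z}

lemma openHull_subset {s : Set E} (hs : Convex ℝ s) (hT : ∀ i, T i ∈ s) : openHull T ⊆ s := by
  rintro _ ⟨u, hu, hsum, rfl⟩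
  exact hs.sum_mem (fun i _ => (hu i).le) hsum fun i _ => hT i

lemma openHull_pair (x y : E) : openHull ![x, y] = openSegment ℝ x y := by
  ext z
  constructor
  · rintro ⟨u, hu, hsum, rfl⟩
    exact ⟨u 0, u 1, hu 0, hu 1, by simpa using hsum, by simp⟩
  · rintro ⟨a, b, ha, hb, hab, rfl⟩
    exact ⟨![a, b], by simp [Fin.forall_fin_two, ha, hb], by simpa using hab, by simp⟩

lemma add_mem_openHull {z : E} (hz : z ∈ openHull T) (d : E) :
    z + d ∈ openHull fun i => T i + d := by
  obtain ⟨u, hu, hsum, rfl⟩ := hz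
  exact ⟨u, hu, hsum, by
    simp only [smul_add, Finset.sum_add_distrib, ← Finset.sum_smul, hsum, one_smul]⟩

lemma disjoint_openHull (f : E →ₗ[ℝ] ℝ) (hle : ∀ i j, f (T i) ≤ f (S j))
    (hlt : ∃ i j, f (T i) < f (S j)) : Disjoint (openHull T) (openHull S) := by
  obtain ⟨i₀, j₀, hlt⟩ := hlt
  refine Set.disjoint_left.2 ?_
  rintro z ⟨u, hu, hu1, hzu⟩ ⟨v, hv, hv1, hzv⟩
  have hT : ∑ i, ∑ j, u i * v j * f (T i) = f z := by
    simp only [← hzu, map_sum, map_smul, smul_eq_mul, ← Finset.sum_mul, ← Finset.mul_sum, hv1,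
      mul_one]
  have hS : ∑ i, ∑ j, u i * v j * f (S j) = f z := by
    simp only [← hzv, map_sum, map_smul, smul_eq_mul, mul_assoc, ← Finset.mul_sum,
      ← Finset.sum_mul, hu1, one_mul]
  have hterm (i j) : u i * v j * f (T i) ≤ u i * v j * f (S j) :=
    mul_le_mul_of_nonneg_left (hle i j) (mul_pos (hu i) (hv j)).le
  refine (hT.trans hS.symm).not_lt (Finset.sum_lt_sum (fun i _ => Finset.sum_le_sum fun j _ =>
    hterm i j) ⟨i₀, Finset.mem_univ _, Finset.sum_lt_sum (fun j _ => hterm i₀ j)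
      ⟨j₀, Finset.mem_univ _, mul_lt_mul_of_pos_left hlt (mul_pos (hu i₀) (hv j₀))⟩⟩)

end OpenHull

/-- The embedding of the integral lattice into the plane. -/
def toPlane : ℤ × ℤ →+ ℝ × ℝ := (Int.castAddHom ℝ).prodMap (Int.castAddHom ℝ)

/-- The determinant of two integral vectors. -/
def cross (v w : ℤ × ℤ) : ℤ := v.1 * w.2 - v.2 * w.1

section Separated

variable {m n : ℕ} {T : Fin m → ℤ × ℤ} {S : Fin n → ℤ × ℤ}

/-- A line with direction `v` weakly separates `T` on its right from `S` on its left and does not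
contain both. -/
def SeparatedAlong (v : ℤ × ℤ) (T : Fin m → ℤ × ℤ) (S : Fin n → ℤ × ℤ) : Prop :=
  (∀ i j, cross v (T i) ≤ cross v (S j)) ∧ ∃ i j, cross v (T i) < cross v (S j)

/-- The polygons `T` and `S` are separated along a coordinate axis or along a line through two of
their corners. -/
def Separated (T : Fin m → ℤ × ℤ) (S : Fin n → ℤ × ℤ) : Prop :=
  (∃ v ∈ [(1, 0), (0, 1), (-1, 0), (0, -1)], SeparatedAlong v T S) ∨
    (∃ i j, SeparatedAlong (T i - T j) T S) ∨ ∃ i j, SeparatedAlong (S i - S j) T S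

instance (v : ℤ × ℤ) (T : Fin m → ℤ × ℤ) (S : Fin n → ℤ × ℤ) :
    Decidable (SeparatedAlong v T S) := by unfold SeparatedAlong; infer_instance

instance (T : Fin m → ℤ × ℤ) (S : Fin n → ℤ × ℤ) : Decidable (Separated T S) := by
  unfold Separated; infer_instance

lemma SeparatedAlong.disjoint {v : ℤ × ℤ} (h : SeparatedAlong v T S) :
    Disjoint (openHull (toPlane ∘ T)) (openHull (toPlane ∘ S)) := by
  have hcross (w : ℤ × ℤ) : ((v.1 : ℝ) • LinearMap.snd ℝ ℝ ℝ - (v.2 : ℝ) • LinearMap.fst ℝ ℝ ℝ)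
      (toPlane w) = cross v w := by simp [cross, toPlane]
  refine disjoint_openHull ((v.1 : ℝ) • LinearMap.snd ℝ ℝ ℝ - (v.2 : ℝ) • LinearMap.fst ℝ ℝ ℝ)
    ?_ ?_ <;> simp only [comp_apply, hcross, Int.cast_le, Int.cast_lt]
  exacts [h.1, h.2]

lemma Separated.disjoint (h : Separated T S) :
    Disjoint (openHull (toPlane ∘ T)) (openHull (toPlane ∘ S)) := by
  rcases h with ⟨_, -, h⟩ | ⟨_, _, h⟩ | ⟨_, _, h⟩ <;> exact h.disjoint

end Separated

section Torus

variable {N : ℤ} {z w : ℝ × ℝ}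

/-- The covering of the torus by the plane whose deck transformations are the translations by
`N • (ℤ × ℤ)`. -/
noncomputable def torusProj (N : ℤ) : C(ℝ × ℝ, Graph.Torus) :=
  ⟨fun z => (((z.1 / N : ℝ) : UnitAddCircle), ((z.2 / N : ℝ) : UnitAddCircle)), by
    have := AddCircle.continuous_mk' (1 : ℝ)
    fun_prop⟩

/-- The translations `d` for which `N • d` can move a point of the square `[-N, N)²` to another. -/
def unitShifts : List (ℤ × ℤ) := [-1, 0, 1] ×ˢ [-1, 0, 1]

/-- The polygon `T`, translated by `N • d`. -/
def translate {m : ℕ} (N : ℤ) (d : ℤ × ℤ) (T : Fin m → ℤ × ℤ) (i : Fin m) : ℤ × ℤ :=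
  T i + (N * d.1, N * d.2)

/-- The square `[-N, N)²`. -/
def box (N : ℤ) : Set (ℝ × ℝ) := Ico (-N : ℝ) N ×ˢ Ico (-N : ℝ) N

/-- The corners of the polygon `T` are in `box N`. -/
def InBox {m : ℕ} (N : ℤ) (T : Fin m → ℤ × ℤ) : Prop :=
  ∀ i, (-N ≤ (T i).1 ∧ (T i).1 < N) ∧ -N ≤ (T i).2 ∧ (T i).2 < N

instance {m : ℕ} (T : Fin m → ℤ × ℤ) : Decidable (InBox N T) := by unfold InBox; infer_instance

lemma InBox.openHull_subset {m : ℕ} {T : Fin m → ℤ × ℤ} (h : InBox N T) :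
    openHull (toPlane ∘ T) ⊆ box N :=
  GraphDrawing.openHull_subset ((convex_Ico _ _).prod (convex_Ico _ _)) fun i => by
    simpa [box, toPlane] using mod_cast h i

lemma coe_div_eq_coe_div_iff {a b : ℝ} (hN : N ≠ 0) :
    ((a / N : ℝ) : UnitAddCircle) = (b / N : ℝ) ↔ ∃ k : ℤ, a = b + (N * k : ℤ) := by
  have hN' : (N : ℝ) ≠ 0 := Int.cast_ne_zero.2 hN
  rw [← sub_eq_zero, ← AddCircle.coe_sub, AddCircle.coe_eq_zero_iff]
  refine exists_congr fun k => ?_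
  rw [zsmul_eq_mul, mul_one, ← sub_div, eq_div_iff hN', Int.cast_mul, mul_comm, eq_sub_iff_add_eq',
    eq_comm]

lemma torusProj_eq_iff (hN : N ≠ 0) :
    torusProj N z = torusProj N w ↔ ∃ d : ℤ × ℤ, z = w + toPlane (N * d.1, N * d.2) := by
  simp only [torusProj, ContinuousMap.coe_mk, Prod.ext_iff, coe_div_eq_coe_div_iff hN]
  exact ⟨fun ⟨⟨k, hk⟩, l, hl⟩ => ⟨(k, l), hk, hl⟩, fun ⟨d, hk, hl⟩ => ⟨⟨_, hk⟩, _, hl⟩⟩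

lemma mem_unitShifts_of_mem_box (hz : z ∈ box N) (hw : w ∈ box N) {d : ℤ × ℤ}
    (h : z = w + toPlane (N * d.1, N * d.2)) : d ∈ unitShifts := by
  have coord {a b : ℝ} {k : ℤ} (ha : a ∈ Ico (-N : ℝ) N) (hb : b ∈ Ico (-N : ℝ) N)
      (hab : a = b + (N * k : ℤ)) : k ∈ [-1, 0, 1] := by
    obtain ⟨ha₀, ha₁⟩ := ha
    obtain ⟨hb₀, hb₁⟩ := hb
    push_cast at hab
    have hN : (0 : ℝ) < N := by linarith
    have hlow : ((-2 : ℤ) : ℝ) < k := lt_of_mul_lt_mul_left (by push_cast; linarith) hN.le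
    have hhigh : (k : ℝ) < (2 : ℤ) := lt_of_mul_lt_mul_left (by push_cast; linarith) hN.le
    rw [Int.cast_lt] at hlow hhigh
    simp only [List.mem_cons, List.not_mem_nil, or_false]
    lia
  exact List.mem_product.2 ⟨coord hz.1 hw.1 (congrArg Prod.fst h),
    coord hz.2 hw.2 (congrArg Prod.snd h)⟩

variable {m n : ℕ} {T : Fin m → ℤ × ℤ} {S : Fin n → ℤ × ℤ}

lemma exists_translate_of_torusProj_eq (hN : N ≠ 0) (hT : InBox N T) (hS : InBox N S)
    (hz : z ∈ openHull (toPlane ∘ T)) (hw : w ∈ openHull (toPlane ∘ S))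
    (h : torusProj N z = torusProj N w) :
    ∃ d ∈ unitShifts, z = w + toPlane (N * d.1, N * d.2) ∧
      z ∈ openHull (toPlane ∘ translate N d S) := by
  obtain ⟨d, rfl⟩ := (torusProj_eq_iff hN).1 h
  refine ⟨d, mem_unitShifts_of_mem_box (hT.openHull_subset hz) (hS.openHull_subset hw) rfl, rfl, ?_⟩
  have htranslate : toPlane ∘ translate N d S =
      fun i => (toPlane ∘ S) i + toPlane (N * d.1, N * d.2) := funext fun i => map_add ..
  rw [htranslate]
  exact add_mem_openHull hw _

theorem disjoint_image_torusProj (hN : N ≠ 0) (hT : InBox N T) (hS : InBox N S)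
    (h : ∀ d ∈ unitShifts, Separated T (translate N d S)) :
    Disjoint (torusProj N '' openHull (toPlane ∘ T)) (torusProj N '' openHull (toPlane ∘ S)) := by
  refine Set.disjoint_left.2 ?_
  rintro _ ⟨z, hz, rfl⟩ ⟨w, hw, hwz⟩
  obtain ⟨d, hd, -, hzd⟩ := exists_translate_of_torusProj_eq hN hT hS hz hw hwz.symm
  exact Set.disjoint_left.1 (h d hd).disjoint hz hzd

theorem injOn_torusProj (hN : N ≠ 0) (hT : InBox N T)
    (h : ∀ d ∈ unitShifts, d ≠ 0 → Separated T (translate N d T)) :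
    InjOn (torusProj N) (openHull (toPlane ∘ T)) := by
  intro z hz w hw hzw
  obtain ⟨d, hd, hzd, hzd'⟩ := exists_translate_of_torusProj_eq hN hT hT hz hw hzw
  by_cases hd0 : d = 0
  · subst hd0
    simpa only [Prod.fst_zero, Prod.snd_zero, mul_zero, Prod.mk_zero_zero, map_zero, add_zero]
      using hzd
  · exact absurd hzd' (Set.disjoint_left.1 (h d hd hd0).disjoint hz)

end Torus

end GraphDrawing

/-! ### Straight drawings on the torus -/

namespace GraphDrawing

open Set Function unitInterval

section TriangleMap

variable {E : Type*} [AddCommGroup E] [Module ℝ E]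

/-- The affine map that sends the corners `(-1/2, 0)`, `(1/2, 0)` and `(0, 1)` of the triangle
`earRegion` to `a`, `b` and `c`. -/
noncomputable def triangleMap (a b c : E) (w : ℝ × ℝ) : E :=
  ((1 - w.2) / 2 - w.1) • a + ((1 - w.2) / 2 + w.1) • b + w.2 • c

variable {a b c : E}

lemma triangleMap_base (r : ℝ) :
    triangleMap a b c (r, 0) = AffineMap.lineMap a b (1 / 2 + r) := by
  simp only [triangleMap, AffineMap.lineMap_apply_module]
  module

lemma triangleMap_apex : triangleMap a b c (0, 1) = c := by
  simp [triangleMap]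

lemma mapsTo_triangleMap : MapsTo (triangleMap a b c) earRegion (openHull ![a, b, c]) := by
  rintro w ⟨hw, hw'⟩
  obtain ⟨hlow, hhigh⟩ := abs_lt.1 hw'
  refine ⟨![(1 - w.2) / 2 - w.1, (1 - w.2) / 2 + w.1, w.2], ?_, ?_, ?_⟩
  · rw [Fin.forall_fin_succ, Fin.forall_fin_two]
    exact ⟨sub_pos.2 hhigh, neg_lt_iff_pos_add'.1 hlow, hw⟩
  · simp only [Fin.sum_univ_three, Matrix.cons_val]
    ring
  · simp [Fin.sum_univ_three, triangleMap]

lemma injective_triangleMap (h : LinearIndependent ℝ ![b - a, c - a]) :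
    Injective (triangleMap a b c) := by
  intro w w' hww'
  have hcomb : (w.1 - w'.1 - (w.2 - w'.2) / 2) • (b - a) + (w.2 - w'.2) • (c - a) = 0 := by
    rw [← sub_eq_zero.2 hww', triangleMap, triangleMap]
    module
  obtain ⟨h₁, h₂⟩ := LinearIndependent.pair_iff.1 h _ _ hcomb
  ext <;> linarith

end TriangleMap

lemma linearIndependent_of_cross_ne_zero {v w : ℤ × ℤ} (h : cross v w ≠ 0) :
    LinearIndependent ℝ ![toPlane v, toPlane w] := by
  refine LinearIndependent.pair_iff.2 fun s t hst => ?_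
  have hdet : (v.1 : ℝ) * w.2 - v.2 * w.1 ≠ 0 := mod_cast h
  have h₁ : s * v.1 + t * w.1 = 0 := congrArg Prod.fst hst
  have h₂ : s * v.2 + t * w.2 = 0 := congrArg Prod.snd hst
  constructor
  · refine (mul_eq_zero.1 ?_).resolve_right hdet
    linear_combination (w.2 : ℝ) * h₁ - (w.1 : ℝ) * h₂
  · refine (mul_eq_zero.1 ?_).resolve_right hdet
    linear_combination (v.1 : ℝ) * h₂ - (v.2 : ℝ) * h₁

/-- An enumeration of the edges of a graph, with a direction for each edge. -/
structure EdgeEnumeration {α β : Type*} (G : Graph α β) (ι : Type*) where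
  edge : ι → β
  tail : ι → α
  head : ι → α
  isLink : ∀ i, G.IsLink (edge i) (tail i) (head i)
  injective : Injective edge
  surjOn : ∀ e ∈ G.edgeSet, ∃ i, edge i = e

/-- A drawing with straight edges on the torus, with integral data so that its validity can be
computed. The torus is the quotient of the plane by `N • (ℤ × ℤ)`; the vertex `x` is at `pos x`, and
the edge `i` lifts to the segment from the position of its tail to that of its head translated by
`N • off i`. -/
structure StraightDrawing (α ι : Type*) where
  N : ℤ
  pos : α → ℤ × ℤ
  off : ι → ℤ × ℤ

namespace StraightDrawing

variable {α β ι : Type*} {G : Graph α β} (E : EdgeEnumeration G ι) (D : StraightDrawing α ι)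

/-- The end of the edge `i` in the plane. -/
def headPos (i : ι) : ℤ × ℤ := D.pos (E.head i) + (D.N * (D.off i).1, D.N * (D.off i).2)

/-- The vertices and edges of the drawing in the plane; a vertex is a degenerate segment. -/
def segment : α ⊕ ι → Fin 2 → ℤ × ℤ :=
  Sum.elim (fun x => ![D.pos x, D.pos x]) fun i => ![D.pos (E.tail i), D.headPos E i]

/-- The triangle in the plane with the edge `i` as base and with the apex `a`. -/
def ear (i : ι) (a : ℤ × ℤ) : Fin 3 → ℤ × ℤ := ![D.pos (E.tail i), D.headPos E i, a]

/-- Distinct vertices and edges of the drawing are disjoint on the torus, and no edge meets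
itself. -/
structure IsValid : Prop where
  N_ne_zero : D.N ≠ 0
  inBox : ∀ k, InBox D.N (D.segment E k)
  pos_ne : ∀ i, D.pos (E.tail i) ≠ D.headPos E i
  separated : ∀ k l, ∀ d ∈ unitShifts, (k, (0, 0)) ≠ (l, d) →
    Separated (D.segment E k) (translate D.N d (D.segment E l))

/-- The open triangle `D.ear E i a` is embedded on the torus off the drawing. -/
structure IsValidEar (i : ι) (a : ℤ × ℤ) : Prop where
  inBox : InBox D.N (D.ear E i a)
  cross_ne_zero : cross (D.headPos E i - D.pos (E.tail i)) (a - D.pos (E.tail i)) ≠ 0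
  separated : ∀ k, ∀ d ∈ unitShifts,
    Separated (D.ear E i a) (translate D.N d (D.segment E k))
  separated_self : ∀ d ∈ unitShifts, d ≠ 0 →
    Separated (D.ear E i a) (translate D.N d (D.ear E i a))

/-- On the torus, the point `a` is the midpoint of the edge `j` of the drawing. -/
def IsMidpoint (j : ι) (a : ℤ × ℤ) : Prop :=
  ∃ d ∈ unitShifts, let v := a - (D.N * d.1, D.N * d.2)
    v + v = D.pos (E.tail j) + D.headPos E j

/-- The image of a vertex on the torus. -/
noncomputable def vertexPoint (x : α) : Graph.Torus := torusProj D.N (toPlane (D.pos x))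

/-- The curve of the edge `i` on the torus, defined on the whole real line. -/
noncomputable def line (i : ι) : C(ℝ, Graph.Torus) :=
  (torusProj D.N).comp
    ⟨AffineMap.lineMap (toPlane (D.pos (E.tail i))) (toPlane (D.headPos E i)),
      AffineMap.lineMap_continuous⟩

/-- The curve of an edge on the torus, constant for `e ∉ E(G)`. -/
noncomputable def edgeCurve : β → C(I, Graph.Torus) :=
  extend E.edge (fun i => (D.line E i).restrict I) fun _ => ContinuousMap.const I 0

variable {E D}

@[simp]
lemma edgeCurve_edge (i : ι) : D.edgeCurve E (E.edge i) = (D.line E i).restrict I :=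
  E.injective.extend_apply _ _ _

lemma torusProj_headPos (hN : D.N ≠ 0) (i : ι) :
    torusProj D.N (toPlane (D.headPos E i)) = D.vertexPoint (E.head i) :=
  (torusProj_eq_iff hN).2 ⟨D.off i, map_add ..⟩

lemma toPlane_comp_pair (a b : ℤ × ℤ) : toPlane ∘ ![a, b] = ![toPlane a, toPlane b] :=
  (FinVec.map_eq toPlane ![a, b]).symm

lemma cell_edgeCurve (k : α ⊕ ι) :
    cell D.vertexPoint (D.edgeCurve E) (k.map id E.edge) =
      torusProj D.N '' openHull (toPlane ∘ D.segment E k) := by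
  rcases k with x | i
  · simp [cell, segment, vertexPoint, toPlane_comp_pair, openHull_pair]
  · simp only [cell, segment, Sum.map_inr, Sum.elim_inr, edgeCurve_edge, openArc_restrict,
      toPlane_comp_pair, openHull_pair, openSegment_eq_image_lineMap, image_image]
    rfl

lemma exists_map_eq_of_mem_cells {k : α ⊕ β} (hk : k ∈ cells G) :
    ∃ k' : α ⊕ ι, k'.map id E.edge = k := by
  obtain ⟨x, -, rfl⟩ | ⟨e, he, rfl⟩ := hk
  · exact ⟨Sum.inl x, rfl⟩
  · obtain ⟨i, rfl⟩ := E.surjOn e he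
    exact ⟨Sum.inr i, rfl⟩

lemma toPlane_injective : Injective toPlane :=
  Int.cast_injective.prodMap Int.cast_injective

namespace IsValid

lemma injOn_line (h : D.IsValid E) (i : ι) : InjOn (D.line E i) (Ioo 0 1) := by
  have hproj : InjOn (torusProj D.N) (openHull (toPlane ∘ D.segment E (Sum.inr i))) :=
    injOn_torusProj h.N_ne_zero (h.inBox _) fun d hd hd0 =>
      h.separated _ _ d hd fun heq => hd0 (congrArg Prod.snd heq).symm
  rw [segment, Sum.elim_inr, toPlane_comp_pair, openHull_pair, openSegment_eq_image_lineMap]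
    at hproj
  exact hproj.comp (AffineMap.lineMap_injective ℝ (toPlane_injective.ne (h.pos_ne i))).injOn
    (mapsTo_image _ _)

theorem isEmbedding (h : D.IsValid E) : G.IsEmbedding D.vertexPoint (D.edgeCurve E) := by
  refine isEmbedding_iff.2 ⟨fun k hk l hl hkl => ?_, fun e x y hxy => ?_, fun e he => ?_⟩
  · obtain ⟨k, rfl⟩ := exists_map_eq_of_mem_cells (E := E) hk
    obtain ⟨l, rfl⟩ := exists_map_eq_of_mem_cells (E := E) hl
    rw [onFun, cell_edgeCurve, cell_edgeCurve]
    exact disjoint_image_torusProj h.N_ne_zero (h.inBox k) (h.inBox l) fun d hd =>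
      h.separated k l d hd fun heq => hkl (congrArg (Sum.map id E.edge) (congrArg Prod.fst heq))
  · obtain ⟨i, rfl⟩ := E.surjOn e hxy.edge_mem
    have hends : s(E.tail i, E.head i) = s(x, y) := by
      simpa using (E.isLink i).eq_and_eq_or_eq_and_eq hxy
    rw [← Sym2.map_mk D.vertexPoint, ← hends, Sym2.map_mk, edgeCurve_edge,
      ← torusProj_headPos h.N_ne_zero]
    simp [line, vertexPoint]
  · obtain ⟨i, rfl⟩ := E.surjOn e he
    rw [edgeCurve_edge]
    exact (isArc_restrict (h.injOn_line i)).injOn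

end IsValid

variable (E D) in
/-- The map that draws the triangle `D.ear E i a` on the torus. -/
noncomputable def earMap (i : ι) (a : ℤ × ℤ) : C(ℝ × ℝ, Graph.Torus) :=
  (torusProj D.N).comp
    ⟨triangleMap (toPlane (D.pos (E.tail i))) (toPlane (D.headPos E i)) (toPlane a), by
      unfold triangleMap; fun_prop⟩

lemma earMap_base (i : ι) (a : ℤ × ℤ) (r : ℝ) : D.earMap E i a (r, 0) = D.line E i (1 / 2 + r) :=
  congrArg (torusProj D.N) (triangleMap_base r)

theorem IsValidEar.isEar {i : ι} {a : ℤ × ℤ} (h : D.IsValidEar E i a) (hD : D.IsValid E) :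
    IsEar G D.vertexPoint (D.edgeCurve E) (E.edge i) (D.earMap E i a) := by
  have hcorners : toPlane ∘ D.ear E i a =
      ![toPlane (D.pos (E.tail i)), toPlane (D.headPos E i), toPlane a] :=
    (FinVec.map_eq toPlane _).symm
  have hmaps := hcorners ▸ mapsTo_triangleMap
  have hinj : Injective
      (triangleMap (toPlane (D.pos (E.tail i))) (toPlane (D.headPos E i)) (toPlane a)) :=
    injective_triangleMap (by
      simpa only [map_sub] using linearIndependent_of_cross_ne_zero h.cross_ne_zero)
  have hshift : MapsTo (fun r : ℝ => 1 / 2 + r) (Ioo (-(1 / 2)) (1 / 2)) (Ioo 0 1) :=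
    fun r hr => ⟨by linarith [hr.1], by linarith [hr.2]⟩
  refine ⟨(injOn_torusProj hD.N_ne_zero h.inBox h.separated_self).comp hinj.injOn hmaps,
    fun w hw k hk => ?_, fun r hr => ?_, ?_⟩
  · obtain ⟨k, rfl⟩ := exists_map_eq_of_mem_cells (E := E) hk.1
    rw [cell_edgeCurve]
    exact Set.disjoint_left.1 (disjoint_image_torusProj hD.N_ne_zero h.inBox (hD.inBox k)
      (h.separated k)) (mem_image_of_mem _ (hmaps hw))
  · rw [earMap_base, edgeCurve_edge, openArc_restrict]
    exact mem_image_of_mem _ (hshift hr)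
  · simp only [earMap_base]
    exact (hD.injOn_line i).comp (add_right_injective _).injOn hshift

lemma IsMidpoint.mem_openArc {j : ι} {a : ℤ × ℤ} (h : D.IsMidpoint E j a) (hN : D.N ≠ 0)
    (i : ι) : D.earMap E i a (0, 1) ∈ openArc (D.edgeCurve E (E.edge j)) := by
  obtain ⟨d, -, hd⟩ := h
  rw [edgeCurve_edge, openArc_restrict]
  refine ⟨1 / 2, by norm_num, ?_⟩
  have hmid : toPlane a = midpoint ℝ (toPlane (D.pos (E.tail j))) (toPlane (D.headPos E j)) +
      toPlane (D.N * d.1, D.N * d.2) := by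
    have hd' := congrArg toPlane hd
    simp only [map_add, map_sub] at hd'
    rw [midpoint_eq_smul_add, ← hd', invOf_eq_inv]
    module
  have hline : D.line E j (1 / 2) = torusProj D.N
      (midpoint ℝ (toPlane (D.pos (E.tail j))) (toPlane (D.headPos E j))) :=
    congrArg (torusProj D.N) (lineMap_one_half _ _)
  have hapex : D.earMap E i a (0, 1) = torusProj D.N (toPlane a) :=
    congrArg (torusProj D.N) triangleMap_apex
  rw [hline, hapex]
  exact ((torusProj_eq_iff hN).2 ⟨d, hmid⟩).symm

end StraightDrawing

end GraphDrawing

/-! ### Girth of one-edge additions -/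

namespace OneEdgeAddition

variable {α β : Type*} {G : Graph α β} {e e₁ e₂ : β} {x y x₁ y₁ x₂ y₂ : α}

lemma four_le_egirth_iff {V : Type*} {G : SimpleGraph V} : 4 ≤ G.egirth ↔ G.CliqueFree 3 := by
  simp only [SimpleGraph.le_egirth, SimpleGraph.CliqueFree, ← not_exists,
    SimpleGraph.is3Clique_iff_exists_cycle_length_three]
  refine ⟨fun h ⟨a, w, hw, hlen⟩ => ?_, fun h a w hw => ?_⟩
  · have h4 : 4 ≤ w.length := by exact_mod_cast h a w hw
    omega
  · have hne : w.length ≠ 3 := fun hlen => h ⟨a, w, hw, hlen⟩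
    exact_mod_cast lt_of_le_of_ne hw.three_le_length hne.symm

lemma girthGeFour_iff :
    G.GirthGeFour ↔ G.Simple ∧ ∀ a b c, G.Adj a b → G.Adj a c → ¬ G.Adj b c := by
  classical
  refine and_congr_right fun _ => four_le_egirth_iff.trans ⟨fun h a b c hab hac hbc => ?_,
    fun h s hs => ?_⟩
  · let triangle : Finset G.vertexSet :=
      {⟨a, hab.left_mem⟩, ⟨b, hbc.left_mem⟩, ⟨c, hbc.right_mem⟩}
    refine h triangle (SimpleGraph.is3Clique_triple_iff.2 ?_)
    simpa only [Graph.toSimpleGraph_adj_iff] using ⟨hab, hac, hbc⟩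
  · obtain ⟨a, b, c, hab, hac, hbc, -⟩ := SimpleGraph.is3Clique_iff.1 hs
    exact h a b c hab.2 hac.2 hbc.2

lemma simple_replaceEdges [G.Simple] {D : Set β} {n : ℕ} {new : Fin n → Sym2 (α ⊕ Fin 2)}
    (hloop : ∀ i, ¬ (new i).IsDiag) (hinj : new.Injective) (hnew : ∀ i, ∃ j, Sum.inr j ∈ new i) :
    (G.replaceEdges D new).Simple where
  not_isLoopAt := by
    rintro (f | i) a h
    · obtain ⟨-, c, d, hl, rfl, hd⟩ := h
      exact hl.ne (Sum.inl_injective hd)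
    · exact hloop i (h.1 ▸ Sym2.diag_isDiag a)
  eq_of_isLink := by
    have hold (i : Fin n) (a b : α) : new i ≠ s(Sum.inl a, Sum.inl b) := fun h => by
      obtain ⟨j, hj⟩ := hnew i
      simp [h] at hj
    rintro (f | i) (g | j) a b h h'
    · obtain ⟨-, c, d, hl, rfl, rfl⟩ := h
      obtain ⟨-, c', d', hl', hc, hd⟩ := h'
      cases hc
      cases hd
      rw [hl.eq hl']
    · obtain ⟨-, c, d, -, rfl, rfl⟩ := h
      exact (hold j c d h'.1).elim
    · obtain ⟨-, c, d, -, rfl, rfl⟩ := h'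
      exact (hold i c d h.1).elim
    · rw [hinj (h.1.trans h'.1.symm)]

lemma not_girthGeFour_addLoop : ¬ (G.addLoop e x y).GirthGeFour := by
  rintro ⟨h, -⟩
  exact h.not_isLoopAt (Sum.inr 3) (Sum.inr 1) ⟨rfl, Or.inr ⟨1, rfl⟩, Or.inr ⟨1, rfl⟩⟩

lemma not_girthGeFour_addParallel : ¬ (G.addParallel e x y).GirthGeFour := by
  rintro ⟨h, -⟩
  have heq := h.eq_of_isLink (e := Sum.inr 1) (f := Sum.inr 3) (x := Sum.inr 0) (y := Sum.inr 1)
    ⟨rfl, Or.inr ⟨0, rfl⟩, Or.inr ⟨1, rfl⟩⟩ ⟨rfl, Or.inr ⟨0, rfl⟩, Or.inr ⟨1, rfl⟩⟩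
  simp at heq

lemma simple_addChord [G.Simple] (h₁ : x₁ ≠ y₁) (h₂ : x₂ ≠ y₂) :
    (G.addChord e₁ x₁ y₁ e₂ x₂ y₂).Simple := by
  refine simple_replaceEdges (fun i => ?_) (fun i j h => ?_) fun i => ?_
  · fin_cases i <;> simp
  · fin_cases i <;> fin_cases j <;> simp_all
  · fin_cases i <;> simp

lemma exists_isLink_of_addChord_adj_inl {a b : α}
    (h : (G.addChord e₁ x₁ y₁ e₂ x₂ y₂).Adj (Sum.inl a) (Sum.inl b)) :
    ∃ f, f ≠ e₁ ∧ f ≠ e₂ ∧ G.IsLink f a b := by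
  obtain ⟨f | i, h⟩ := h
  · obtain ⟨hf, c, d, hl, hc, hd⟩ := h
    cases hc
    cases hd
    exact ⟨f, by simp_all, by simp_all, hl⟩
  · obtain ⟨h, -⟩ := h
    fin_cases i <;> simp at h

lemma eq_of_addChord_adj_inr_zero {b : α ⊕ Fin 2}
    (h : (G.addChord e₁ x₁ y₁ e₂ x₂ y₂).Adj (Sum.inr 0) b) :
    b = Sum.inl x₁ ∨ b = Sum.inl y₁ ∨ b = Sum.inr 1 := by
  obtain ⟨f | i, h⟩ := h
  · obtain ⟨-, c, d, -, hc, -⟩ := h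
    cases hc
  · obtain ⟨h, -⟩ := h
    fin_cases i <;> simp_all

lemma eq_of_addChord_adj_inr_one {b : α ⊕ Fin 2}
    (h : (G.addChord e₁ x₁ y₁ e₂ x₂ y₂).Adj (Sum.inr 1) b) :
    b = Sum.inl x₂ ∨ b = Sum.inl y₂ ∨ b = Sum.inr 0 := by
  obtain ⟨f | i, h⟩ := h
  · obtain ⟨-, c, d, -, hc, -⟩ := h
    cases hc
  · obtain ⟨h, -⟩ := h
    fin_cases i <;> simp_all

lemma addChord_not_adj_of_adj_inr [G.Simple] (h₁ : G.IsLink e₁ x₁ y₁) (h₂ : G.IsLink e₂ x₂ y₂)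
    (hdisj : Disjoint ({x₁, y₁} : Set α) {x₂, y₂}) (i : Fin 2) {b c : α ⊕ Fin 2}
    (hb : (G.addChord e₁ x₁ y₁ e₂ x₂ y₂).Adj (Sum.inr i) b)
    (hc : (G.addChord e₁ x₁ y₁ e₂ x₂ y₂).Adj (Sum.inr i) c) :
    ¬ (G.addChord e₁ x₁ y₁ e₂ x₂ y₂).Adj b c := by
  have := simple_addChord (G := G) (e₁ := e₁) (e₂ := e₂) h₁.ne h₂.ne
  have hold₁ : ¬ (G.addChord e₁ x₁ y₁ e₂ x₂ y₂).Adj (Sum.inl x₁) (Sum.inl y₁) := fun h => by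
    obtain ⟨f, hf, -, hl⟩ := exists_isLink_of_addChord_adj_inl h
    exact hf (hl.eq h₁)
  have hold₂ : ¬ (G.addChord e₁ x₁ y₁ e₂ x₂ y₂).Adj (Sum.inl x₂) (Sum.inl y₂) := fun h => by
    obtain ⟨f, -, hf, hl⟩ := exists_isLink_of_addChord_adj_inl h
    exact hf (hl.eq h₂)
  have hsymm : ∀ {a b}, (G.addChord e₁ x₁ y₁ e₂ x₂ y₂).Adj a b →
    (G.addChord e₁ x₁ y₁ e₂ x₂ y₂).Adj b a := Graph.Adj.symm
  have hirrefl : ∀ a, ¬ (G.addChord e₁ x₁ y₁ e₂ x₂ y₂).Adj a a := Graph.not_adj_self _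
  have hfar {a : α} (h0 : (G.addChord e₁ x₁ y₁ e₂ x₂ y₂).Adj (Sum.inr 0) (Sum.inl a)) :
      ¬ (G.addChord e₁ x₁ y₁ e₂ x₂ y₂).Adj (Sum.inr 1) (Sum.inl a) := fun h1 => by
    have ha₁ : a ∈ ({x₁, y₁} : Set α) := by simpa using eq_of_addChord_adj_inr_zero h0
    have ha₂ : a ∈ ({x₂, y₂} : Set α) := by simpa using eq_of_addChord_adj_inr_one h1
    exact Set.disjoint_left.1 hdisj ha₁ ha₂
  fin_cases i
  · obtain rfl | rfl | rfl := eq_of_addChord_adj_inr_zero hb <;>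
      obtain rfl | rfl | rfl := eq_of_addChord_adj_inr_zero hc <;> grind
  · obtain rfl | rfl | rfl := eq_of_addChord_adj_inr_one hb <;>
      obtain rfl | rfl | rfl := eq_of_addChord_adj_inr_one hc <;> grind

theorem girthGeFour_addChord (hG : G.GirthGeFour) (h₁ : G.IsLink e₁ x₁ y₁)
    (h₂ : G.IsLink e₂ x₂ y₂) (hdisj : Disjoint ({x₁, y₁} : Set α) {x₂, y₂}) :
    (G.addChord e₁ x₁ y₁ e₂ x₂ y₂).GirthGeFour := by
  obtain ⟨hsimple, htriangle⟩ := girthGeFour_iff.1 hG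
  refine girthGeFour_iff.2 ⟨simple_addChord h₁.ne h₂.ne, ?_⟩
  rintro (a | i) b c hab hac hbc
  · obtain b | j := b
    · obtain c | k := c
      · obtain ⟨_, -, -, hab⟩ := exists_isLink_of_addChord_adj_inl hab
        obtain ⟨_, -, -, hac⟩ := exists_isLink_of_addChord_adj_inl hac
        obtain ⟨_, -, -, hbc⟩ := exists_isLink_of_addChord_adj_inl hbc
        exact htriangle a b c hab.adj hac.adj hbc.adj
      · exact addChord_not_adj_of_adj_inr h₁ h₂ hdisj k hac.symm hbc.symm hab
    · exact addChord_not_adj_of_adj_inr h₁ h₂ hdisj j hab.symm hbc hac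
  · exact addChord_not_adj_of_adj_inr h₁ h₂ hdisj i hab hac hbc

theorem disjoint_of_girthGeFour_addChord (h₁ : G.IsLink e₁ x₁ y₁)
    (h : (G.addChord e₁ x₁ y₁ e₂ x₂ y₂).GirthGeFour) :
    Disjoint ({x₁, y₁} : Set α) {x₂, y₂} := by
  refine Set.disjoint_left.2 fun z hz₁ hz₂ => ?_
  have hz : z ∈ G.vertexSet := by
    obtain rfl | rfl := hz₁
    exacts [h₁.left_mem, h₁.right_mem]
  have hold : Sum.inl z ∈ (G.addChord e₁ x₁ y₁ e₂ x₂ y₂).vertexSet := Or.inl ⟨z, hz, rfl⟩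
  have hnew (i) : Sum.inr i ∈ (G.addChord e₁ x₁ y₁ e₂ x₂ y₂).vertexSet := Or.inr ⟨i, rfl⟩
  refine (girthGeFour_iff.1 h).2 (Sum.inl z) (Sum.inr 0) (Sum.inr 1) ?_ ?_
    ⟨Sum.inr 4, rfl, hnew 0, hnew 1⟩
  · obtain rfl | rfl := hz₁
    exacts [⟨Sum.inr 0, rfl, hold, hnew 0⟩, ⟨Sum.inr 1, Sym2.eq_swap, hold, hnew 0⟩]
  · obtain rfl | rfl := hz₂
    exacts [⟨Sum.inr 2, rfl, hold, hnew 1⟩, ⟨Sum.inr 3, Sym2.eq_swap, hold, hnew 1⟩]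

end OneEdgeAddition

/-! ### Two drawings of `F₁₂` -/

open F12Vertex in
instance : Fintype F12Vertex :=
  ⟨⟨[A, A', B, B', v1, v2, v3, v4, v5, v6, v7, v8], by decide⟩, fun x => by cases x <;> decide⟩

namespace F12

open F12Vertex Function GraphDrawing

/-- The tail and the head of each edge, in the order in which `F12` lists the edges. -/
def dart : Fin 18 → F12Vertex × F12Vertex :=
  ![(A, A'), (A, v3), (A', v2), (B, B'), (B, v6), (B', v7), (v2, v3), (v6, v7), (A, v8), (A', v5),
    (B, v1), (B', v4), (v1, v2), (v3, v4), (v5, v6), (v7, v8), (v4, v5), (v8, v1)]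

/-- The `i`th edge. -/
def edge (i : Fin 18) : Sym2 F12Vertex := s((dart i).1, (dart i).2)

lemma adj_iff {x y : F12Vertex} : F12.Adj x y ↔ ∃ i, edge i = s(x, y) := by
  simp only [F12, SimpleGraph.fromEdgeSet_adj, Set.mem_insert_iff, Set.mem_singleton_iff]
  revert x y
  decide +kernel

instance : DecidableRel F12.Adj := fun _ _ => decidable_of_iff _ adj_iff.symm

lemma isLink_iff {e : Sym2 F12Vertex} {x y : F12Vertex} :
    F12Graph.IsLink e x y ↔ e = s(x, y) ∧ F12.Adj x y := by
  constructor <;> rintro ⟨rfl, h⟩ <;> exact ⟨rfl, h⟩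

lemma exists_edge_eq {e : Sym2 F12Vertex} (he : e ∈ F12Graph.edgeSet) : ∃ i, edge i = e := by
  obtain ⟨x, y, h⟩ := Graph.exists_isLink_of_mem_edgeSet he
  obtain ⟨rfl, hadj⟩ := isLink_iff.1 h
  exact adj_iff.1 hadj

/-- The edges of `F₁₂` with the directions given by `dart`. -/
def edgeEnumeration : EdgeEnumeration F12Graph (Fin 18) where
  edge := edge
  tail i := (dart i).1
  head i := (dart i).2
  isLink i := isLink_iff.2 ⟨rfl, adj_iff.2 ⟨i, rfl⟩⟩
  injective := by unfold Injective; decide +kernel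
  surjOn _ := exists_edge_eq

/-- A drawing with faces of lengths 4, 4, 6, 6, 8, 8. -/
def firstDrawing : StraightDrawing F12Vertex (Fin 18) where
  N := 60
  pos
    | A => (0, 0) | A' => (-10, -10) | B => (24, -24) | B' => (14, 26)
    | v1 => (28, -8) | v2 => (-16, -4) | v3 => (-6, 6) | v4 => (-2, 22)
    | v5 => (-14, -26) | v6 => (-30, -30) | v7 => (20, 20) | v8 => (16, 4)
  off := ![(0, 0), (0, 0), (0, 0), (0, -1), (1, 0), (0, 0), (0, 0), (-1, -1), (0, 0), (0, 0),
    (0, 0), (0, 0), (1, 0), (0, 0), (0, 0), (0, 0), (0, 1), (0, 0)]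

/-- A drawing with faces of lengths 5, 5, 5, 5, 8, 8. -/
def secondDrawing : StraightDrawing F12Vertex (Fin 18) where
  N := 40
  pos
    | A => (0, 0) | A' => (4, -14) | B => (-16, 16) | B' => (20, 10)
    | v1 => (-8, 12) | v2 => (0, -24) | v3 => (4, 10) | v4 => (12, 14)
    | v5 => (12, -18) | v6 => (20, -14) | v7 => (-16, 0) | v8 => (-8, 4)
  off := ![(0, 0), (0, 0), (0, 0), (-1, 0), (-1, 1), (1, 0), (0, -1), (1, 0), (0, 0), (0, 0),
    (0, 0), (0, 0), (0, 1), (0, 0), (0, 0), (0, 0), (0, 1), (0, 0)]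

/-- Three drawings, of which two suffice: the last two agree. -/
def drawing : Fin 3 → StraightDrawing F12Vertex (Fin 18) :=
  ![firstDrawing, secondDrawing, secondDrawing]

lemma isValid_firstDrawing : firstDrawing.IsValid edgeEnumeration := by
  constructor <;> decide +kernel

lemma isValid_secondDrawing : secondDrawing.IsValid edgeEnumeration := by
  constructor <;> decide +kernel

lemma isValid_drawing (k : Fin 3) : (drawing k).IsValid edgeEnumeration := by
  fin_cases k
  exacts [isValid_firstDrawing, isValid_secondDrawing, isValid_secondDrawing]

/-- A triangle in one of the drawings: its base is an edge, and its third corner is the point `tip`,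
the midpoint of another edge `apex`. -/
structure Ear where
  drawing : Fin 3
  base : Fin 18
  apex : Fin 18
  tip : ℤ × ℤ

/-- The edges that the ear joins. -/
def Ear.pair (r : Ear) : Sym2 (Sym2 F12Vertex) := s(edge r.base, edge r.apex)

/-- One ear for each of the fourteen cases, and four ears whose edges have a common end. -/
def ear : Fin 14 ⊕ Fin 4 → Ear := Sum.elim
  ![⟨0, 0, 3, (19, -29)⟩, ⟨0, 0, 10, (26, -16)⟩, ⟨1, 0, 4, (-18, -19)⟩, ⟨1, 0, 12, (-4, -26)⟩,
    ⟨0, 0, 6, (-11, 1)⟩, ⟨0, 0, 16, (-8, -32)⟩, ⟨1, 0, 14, (16, -16)⟩, ⟨1, 0, 7, (22, -7)⟩,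
    ⟨0, 8, 9, (-12, -18)⟩, ⟨0, 8, 10, (26, -16)⟩, ⟨0, 8, 11, (6, 24)⟩, ⟨1, 8, 12, (-4, 14)⟩,
    ⟨0, 8, 16, (-8, -32)⟩, ⟨0, 16, 17, (-38, -2)⟩]
  ![⟨0, 0, 1, (-3, 3)⟩, ⟨0, 0, 8, (8, 2)⟩, ⟨0, 8, 15, (18, 12)⟩, ⟨0, 8, 17, (22, -2)⟩]

lemma isValidEar (m : Fin 14 ⊕ Fin 4) :
    (drawing (ear m).drawing).IsValidEar edgeEnumeration (ear m).base (ear m).tip := by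
  constructor <;> revert m <;> decide +kernel

lemma isMidpoint (m : Fin 14 ⊕ Fin 4) :
    (drawing (ear m).drawing).IsMidpoint edgeEnumeration (ear m).apex (ear m).tip := by
  revert m
  unfold StraightDrawing.IsMidpoint
  decide +kernel

end F12

/-! ### Automorphisms of `F₁₂` -/

namespace F12

open F12Vertex GraphDrawing Equiv

/-- Four involutions of the vertices that preserve adjacency. -/
def involution : Fin 4 → Perm F12Vertex :=
  ![swap A' v3 * swap B' v6 * swap v4 v5,
    swap A A' * swap B B' * swap v1 v4 * swap v2 v3 * swap v5 v8 * swap v6 v7,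
    swap A B * swap A' B' * swap v1 v8 * swap v2 v7 * swap v3 v6 * swap v4 v5,
    swap A v2 * swap A' v3 * swap B v7 * swap B' v6 * swap v1 v8 * swap v4 v5]

lemma adj_involution_iff : ∀ k x y, F12.Adj (involution k x) (involution k y) ↔ F12.Adj x y := by
  decide +kernel

/-- The product of the involutions `k` with `b k = true`, as an automorphism. -/
def aut (b : Fin 4 → Bool) : F12 ≃g F12 :=
  (List.ofFn fun k => bif b k then ⟨involution k, adj_involution_iff k _ _⟩ else 1).prod

lemma exists_aut_base : ∀ i, ∃ b m, (edge i).map (aut b) = edge (ear m).base := by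
  decide +kernel

lemma exists_aut_pair : ∀ i j, i ≠ j →
    ∃ b m, s(edge i, edge j).map (Sym2.map (aut b)) = (ear m).pair := by
  decide +kernel

variable {e f : Sym2 F12Vertex}

lemma exists_iso_base (he : e ∈ F12Graph.edgeSet) :
    ∃ (σ : F12 ≃g F12) (m : Fin 14 ⊕ Fin 4), e.map σ = edge (ear m).base := by
  obtain ⟨i, rfl⟩ := exists_edge_eq he
  obtain ⟨b, hb⟩ := exists_aut_base i
  exact ⟨aut b, hb⟩

lemma exists_iso_pair (he : e ∈ F12Graph.edgeSet) (hf : f ∈ F12Graph.edgeSet) (hef : e ≠ f) :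
    ∃ (σ : F12 ≃g F12) (m : Fin 14 ⊕ Fin 4), s(e.map σ, f.map σ) = (ear m).pair := by
  obtain ⟨i, rfl⟩ := exists_edge_eq he
  obtain ⟨j, rfl⟩ := exists_edge_eq hf
  obtain ⟨b, hb⟩ := exists_aut_pair i j fun hij => hef (congrArg edge hij)
  exact ⟨aut b, hb⟩

/-! ### Toroidality of the one-edge additions to `F₁₂` -/

lemma isEmbedding_drawing (k : Fin 3) :
    F12Graph.IsEmbedding (drawing k).vertexPoint ((drawing k).edgeCurve edgeEnumeration) :=
  (isValid_drawing k).isEmbedding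

lemma isEar_ear (m : Fin 14 ⊕ Fin 4) :
    IsEar F12Graph (drawing (ear m).drawing).vertexPoint
      ((drawing (ear m).drawing).edgeCurve edgeEnumeration) (edge (ear m).base)
      ((drawing (ear m).drawing).earMap edgeEnumeration (ear m).base (ear m).tip) :=
  (isValidEar m).isEar (isValid_drawing _)

lemma isJoinable_ear (m : Fin 14 ⊕ Fin 4) :
    IsJoinable F12Graph (drawing (ear m).drawing).vertexPoint
      ((drawing (ear m).drawing).edgeCurve edgeEnumeration) (edge (ear m).base)
      (edge (ear m).apex) :=
  (isEar_ear m).isJoinable ((isMidpoint m).mem_openArc (isValid_drawing _).N_ne_zero _)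

lemma isLink_map (σ : F12 ≃g F12) {x y : F12Vertex} (h : F12Graph.IsLink e x y) :
    F12Graph.IsLink (e.map σ) (σ x) (σ y) := by
  obtain ⟨rfl, hadj⟩ := isLink_iff.1 h
  exact isLink_iff.2 ⟨rfl, σ.map_adj_iff.2 hadj⟩

lemma mapsTo_edgeSet (σ : F12 ≃g F12) :
    Set.MapsTo (Sym2.map σ) F12Graph.edgeSet F12Graph.edgeSet := fun _ he => by
  obtain ⟨x, y, h⟩ := Graph.exists_isLink_of_mem_edgeSet he
  exact (isLink_map σ h).edge_mem

lemma isEmbedding_drawing_comp (k : Fin 3) (σ : F12 ≃g F12) :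
    F12Graph.IsEmbedding ((drawing k).vertexPoint ∘ σ)
      ((drawing k).edgeCurve edgeEnumeration ∘ Sym2.map σ) :=
  isEmbedding_comp (isEmbedding_drawing k) σ.injective (Sym2.map.injective σ.injective)
    (fun _ _ => trivial) fun _ _ _ => isLink_map σ

theorem exists_isEar (he : e ∈ F12Graph.edgeSet) :
    ∃ (p : F12Vertex → Graph.Torus) (γ : Sym2 F12Vertex → C(unitInterval, Graph.Torus)),
      F12Graph.IsEmbedding p γ ∧ ∃ z, IsEar F12Graph p γ e z := by
  obtain ⟨σ, m, hm⟩ := exists_iso_base he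
  exact ⟨_, _, isEmbedding_drawing_comp _ σ, _,
    IsEar.comp (G := F12Graph) (hm ▸ isEar_ear m) (fun _ _ => trivial) (mapsTo_edgeSet σ)⟩

theorem exists_isJoinable (he : e ∈ F12Graph.edgeSet) (hf : f ∈ F12Graph.edgeSet) (hef : e ≠ f) :
    ∃ (p : F12Vertex → Graph.Torus) (γ : Sym2 F12Vertex → C(unitInterval, Graph.Torus)),
      F12Graph.IsEmbedding p γ ∧ IsJoinable F12Graph p γ e f := by
  obtain ⟨σ, m, hm⟩ := exists_iso_pair he hf hef
  refine ⟨_, _, isEmbedding_drawing_comp (ear m).drawing σ,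
    IsJoinable.comp (G := F12Graph) ?_ (fun _ _ => trivial) (mapsTo_edgeSet σ)⟩
  obtain ⟨hbase, hapex⟩ | ⟨hapex, hbase⟩ := Sym2.eq_iff.1 hm
  · exact hbase ▸ hapex ▸ isJoinable_ear m
  · exact (hbase ▸ hapex ▸ isJoinable_ear m).symm

theorem isToroidal_of_isOneEdgeAddition {n : ℕ}
    {H : Graph (F12Vertex ⊕ Fin 2) (Sym2 F12Vertex ⊕ Fin n)} (h : F12Graph.IsOneEdgeAddition H) :
    H.IsToroidal := by
  cases h with
  | loop e x y he =>
    obtain ⟨p, γ, hp, z, hz⟩ := exists_isEar he.edge_mem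
    exact hz.exists_isEmbedding_addLoop hp he
  | parallel e x y he =>
    obtain ⟨p, γ, hp, z, hz⟩ := exists_isEar he.edge_mem
    exact hz.exists_isEmbedding_addParallel hp he
  | chord e f x y x' y' he hf hef =>
    obtain ⟨p, γ, hp, hjoin⟩ := exists_isJoinable he.edge_mem hf.edge_mem hef
    obtain ⟨q, δ, hq, -⟩ := hjoin.exists_extendsToChord hp he hf hef
    exact ⟨q, δ, hq⟩

end F12

/-! ### Classification of the pairs of disjoint edges -/

namespace F12

open F12Vertex Function

variable {x₁ y₁ x₂ y₂ : F12Vertex}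

/-- The pair of edges of the case `i`. -/
def casePair (i : Fin 14) : Sym2 (Sym2 F12Vertex) :=
  s(s((F12Case i).1.1, (F12Case i).1.2), s((F12Case i).2.1, (F12Case i).2.2))

lemma edge_ear_inl : ∀ i, edge (ear (.inl i)).base = s((F12Case i).1.1, (F12Case i).1.2) ∧
    edge (ear (.inl i)).apex = s((F12Case i).2.1, (F12Case i).2.2) := by
  decide +kernel

lemma pair_ear_inl (i : Fin 14) : (ear (.inl i)).pair = casePair i :=
  congrArg₂ (s(·, ·)) (edge_ear_inl i).1 (edge_ear_inl i).2

lemma exists_forall_mem_pair_ear_inr (m : Fin 4) : ∃ v, ∀ e ∈ (ear (.inr m)).pair, v ∈ e := by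
  simp only [Ear.pair, Sym2.ball]
  revert m
  decide +kernel

lemma adj_case (i : Fin 14) : F12.Adj (F12Case i).1.1 (F12Case i).1.2 ∧
    F12.Adj (F12Case i).2.1 (F12Case i).2.2 :=
  ⟨adj_iff.2 ⟨_, (edge_ear_inl i).1⟩, adj_iff.2 ⟨_, (edge_ear_inl i).2⟩⟩

lemma disjoint_case (i : Fin 14) : Disjoint ({(F12Case i).1.1, (F12Case i).1.2} : Set F12Vertex)
    {(F12Case i).2.1, (F12Case i).2.2} := by
  simp only [Set.disjoint_insert_left, Set.disjoint_singleton_left, Set.mem_insert_iff,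
    Set.mem_singleton_iff]
  revert i
  decide +kernel

/-- The vertices adjacent to a given vertex. -/
def neighbors : F12Vertex → Finset F12Vertex
  | A => {A', v3, v8} | A' => {A, v2, v5} | B => {B', v6, v1} | B' => {B, v7, v4}
  | v1 => {B, v2, v8} | v2 => {A', v3, v1} | v3 => {A, v2, v4} | v4 => {B', v3, v5}
  | v5 => {A', v6, v4} | v6 => {B, v7, v5} | v7 => {B', v6, v8} | v8 => {A, v7, v1}

lemma mem_neighbors : ∀ {x y}, y ∈ neighbors x ↔ F12.Adj x y := by decide +kernel

lemma girthGeFour : F12Graph.GirthGeFour := by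
  have htriangle : ∀ x, ∀ y ∈ neighbors x, ∀ z ∈ neighbors x, z ∉ neighbors y := by
    decide +kernel
  refine OneEdgeAddition.girthGeFour_iff.2 ⟨{
      not_isLoopAt := fun e x h => ?_
      eq_of_isLink := fun e f x y h h' => ?_ }, ?_⟩
  · exact (isLink_iff.1 h).2.ne rfl
  · exact (isLink_iff.1 h).1.trans (isLink_iff.1 h').1.symm
  · rintro x y z ⟨e, he⟩ ⟨f, hf⟩ ⟨g, hg⟩
    simp only [isLink_iff, ← mem_neighbors] at he hf hg
    exact htriangle x y he.2 z hf.2 hg.2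

lemma ne_of_disjoint {V : Type*} {x₁ y₁ x₂ y₂ : V}
    (h : Disjoint ({x₁, y₁} : Set V) {x₂, y₂}) : s(x₁, y₁) ≠ s(x₂, y₂) := fun heq =>
  Set.disjoint_left.1 h (Or.inl rfl) (Sym2.mem_iff.1 (heq ▸ Sym2.mem_mk_left x₁ y₁))

lemma exists_sameCase (h₁ : F12.Adj x₁ y₁) (h₂ : F12.Adj x₂ y₂)
    (hdisj : Disjoint ({x₁, y₁} : Set F12Vertex) {x₂, y₂}) : ∃ i, F12SameCase i x₁ y₁ x₂ y₂ := by
  have hnot (v : F12Vertex) (hv : v ∈ s(x₁, y₁)) : v ∉ s(x₂, y₂) := fun hv' =>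
    Set.disjoint_left.1 hdisj (Sym2.mem_iff.1 hv) (Sym2.mem_iff.1 hv')
  obtain ⟨σ, i | m, hm⟩ := exists_iso_pair (isLink_iff.2 ⟨rfl, h₁⟩).edge_mem
    (isLink_iff.2 ⟨rfl, h₂⟩).edge_mem (ne_of_disjoint hdisj)
  · exact ⟨i, σ, hm.trans (pair_ear_inl i)⟩
  · obtain ⟨v, hv⟩ := exists_forall_mem_pair_ear_inr m
    rw [← hm, Sym2.ball] at hv
    obtain ⟨⟨w, hw, rfl⟩, w', hw', heq⟩ := hv.imp Sym2.mem_map.1 Sym2.mem_map.1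
    exact (hnot w hw (σ.injective heq ▸ hw')).elim

section Walks

variable {V : Type*} [DecidableEq V]

/-- The number of walks of length `n` from `x` to `y` in the graph in which `N z` is the set of
neighbors of `z`. It is defined by recursion so that it can be computed. -/
def walkCount (N : V → Finset V) : ℕ → V → V → ℕ
  | 0, x, y => if x = y then 1 else 0
  | n + 1, x, y => ∑ z ∈ N x, walkCount N n z y

/-- The number of closed walks of length `m + n` that are in `s` at the times `0` and `m`. -/
def returnCount (N : V → Finset V) (m n : ℕ) (s : Finset V) : ℕ :=
  ∑ x ∈ s, ∑ y ∈ s, walkCount N m x y * walkCount N n x y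

variable {N : V → Finset V} {σ : V ≃ V}

lemma walkCount_map (hσ : ∀ x, N (σ x) = (N x).map σ.toEmbedding) (n : ℕ) (x y : V) :
    walkCount N n (σ x) (σ y) = walkCount N n x y := by
  induction n generalizing x with
  | zero => simp only [walkCount, σ.injective.eq_iff]
  | succ n ih =>
    simp only [walkCount, hσ, Finset.sum_map, Equiv.coe_toEmbedding, ih]

lemma returnCount_map (hσ : ∀ x, N (σ x) = (N x).map σ.toEmbedding) (m n : ℕ) (s : Finset V) :
    returnCount N m n (s.map σ.toEmbedding) = returnCount N m n s := by
  simp only [returnCount, Finset.sum_map, Equiv.coe_toEmbedding, walkCount_map hσ]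

end Walks

lemma neighbors_map (σ : F12 ≃g F12) (x : F12Vertex) :
    neighbors (σ x) = (neighbors x).map σ.toEquiv.toEmbedding := by
  ext y
  obtain ⟨z, rfl⟩ := σ.surjective y
  rw [mem_neighbors, σ.map_adj_iff, ← mem_neighbors]
  exact (Finset.mem_map' σ.toEquiv.toEmbedding).symm

/-- The ends of the edges of a pair. -/
def endVertices (P : Sym2 (Sym2 F12Vertex)) : Finset F12Vertex := P.toFinset.biUnion Sym2.toFinset

lemma endVertices_map (σ : F12Vertex ≃ F12Vertex) (P : Sym2 (Sym2 F12Vertex)) :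
    endVertices (P.map (Sym2.map σ)) = (endVertices P).map σ.toEmbedding := by
  ext y
  simp only [endVertices, Finset.mem_biUnion, Sym2.mem_toFinset, Sym2.mem_map,
    Finset.mem_map]
  aesop

lemma injective_returnCount_casePair :
    Injective fun i => returnCount neighbors 4 5 (endVertices (casePair i)) := by
  unfold Injective
  decide +kernel

lemma returnCount_of_sameCase {i : Fin 14} (h : F12SameCase i x₁ y₁ x₂ y₂) :
    returnCount neighbors 4 5 (endVertices (casePair i)) =
      returnCount neighbors 4 5 (endVertices s(s(x₁, y₁), s(x₂, y₂))) := by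
  obtain ⟨σ, hσ⟩ := h
  have hσ' : s(s(x₁, y₁), s(x₂, y₂)).map (Sym2.map σ.toEquiv) = casePair i := hσ
  rw [← hσ', endVertices_map, returnCount_map (neighbors_map σ)]

theorem existsUnique_sameCase (h₁ : F12.Adj x₁ y₁) (h₂ : F12.Adj x₂ y₂)
    (hdisj : Disjoint ({x₁, y₁} : Set F12Vertex) {x₂, y₂}) : ∃! i, F12SameCase i x₁ y₁ x₂ y₂ := by
  obtain ⟨i, hi⟩ := exists_sameCase h₁ h₂ hdisj
  exact ⟨i, hi, fun k hk => injective_returnCount_casePair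
    ((returnCount_of_sameCase hk).trans (returnCount_of_sameCase hi).symm)⟩

theorem exists_extendsToChord_case (i : Fin 14) :
    ∃ q δ, (F12Chord (F12Case i).1.1 (F12Case i).1.2 (F12Case i).2.1 (F12Case i).2.2).IsEmbedding
        q δ ∧
      F12Graph.ExtendsToChord s((F12Case i).1.1, (F12Case i).1.2)
        s((F12Case i).2.1, (F12Case i).2.2) (drawing (ear (.inl i)).drawing).vertexPoint
        ((drawing (ear (.inl i)).drawing).edgeCurve edgeEnumeration) q δ := by
  have hjoin := isJoinable_ear (.inl i)
  rw [(edge_ear_inl i).1, (edge_ear_inl i).2] at hjoin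
  obtain ⟨h₁, h₂⟩ := adj_case i
  exact hjoin.exists_extendsToChord (isEmbedding_drawing _) (isLink_iff.2 ⟨rfl, h₁⟩)
    (isLink_iff.2 ⟨rfl, h₂⟩) (ne_of_disjoint (disjoint_case i))

end F12

/-- (1) Every one-edge addition `F₁₂ ∪ e` embeds into the torus.
(2) The additions of girth at least four fall, up to automorphisms of `F₁₂`, into exactly the
fourteen listed cases; no addition of the first two kinds has girth at least four.
(3) There are three embeddings of `F₁₂` into the torus such that in each of the fourteen cases one
of them extends to an embedding of `F₁₂ ∪ e`. -/
theorem mainTheorem7 :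
    (∀ (n : ℕ) (H : Graph (F12Vertex ⊕ Fin 2) (Sym2 F12Vertex ⊕ Fin n)),
      F12Graph.IsOneEdgeAddition H → H.IsToroidal) ∧
    ((∀ x y : F12Vertex, F12.Adj x y →
        ¬ (F12Graph.addLoop s(x, y) x y).GirthGeFour ∧
        ¬ (F12Graph.addParallel s(x, y) x y).GirthGeFour) ∧
      (∀ x₁ y₁ x₂ y₂ : F12Vertex, F12.Adj x₁ y₁ → F12.Adj x₂ y₂ → s(x₁, y₁) ≠ s(x₂, y₂) →
        (F12Chord x₁ y₁ x₂ y₂).GirthGeFour → ∃! i : Fin 14, F12SameCase i x₁ y₁ x₂ y₂) ∧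
      (∀ i : Fin 14,
        (F12Chord (F12Case i).1.1 (F12Case i).1.2 (F12Case i).2.1 (F12Case i).2.2).GirthGeFour)) ∧
    (∃ (p : Fin 3 → F12Vertex → Graph.Torus)
       (γ : Fin 3 → Sym2 F12Vertex → C(unitInterval, Graph.Torus)),
      (∀ k, F12Graph.IsEmbedding (p k) (γ k)) ∧
      ∀ i : Fin 14, ∃ k : Fin 3,
        ∃ (q : F12Vertex ⊕ Fin 2 → Graph.Torus)
          (δ : Sym2 F12Vertex ⊕ Fin 5 → C(unitInterval, Graph.Torus)),
          (F12Chord (F12Case i).1.1 (F12Case i).1.2 (F12Case i).2.1 (F12Case i).2.2).IsEmbedding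
            q δ ∧
          F12Graph.ExtendsToChord s((F12Case i).1.1, (F12Case i).1.2)
            s((F12Case i).2.1, (F12Case i).2.2) (p k) (γ k) q δ) := by
  refine ⟨fun n H => F12.isToroidal_of_isOneEdgeAddition, ⟨fun x y _ =>
    ⟨OneEdgeAddition.not_girthGeFour_addLoop, OneEdgeAddition.not_girthGeFour_addParallel⟩,
    fun x₁ y₁ x₂ y₂ h₁ h₂ _ hgirth => ?_, fun i => ?_⟩,
    fun k => (F12.drawing k).vertexPoint, fun k => (F12.drawing k).edgeCurve F12.edgeEnumeration,
    F12.isEmbedding_drawing, fun i => ⟨(F12.ear (.inl i)).drawing, ?_⟩⟩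
  · exact F12.existsUnique_sameCase h₁ h₂
      (OneEdgeAddition.disjoint_of_girthGeFour_addChord (F12.isLink_iff.2 ⟨rfl, h₁⟩) hgirth)
  · exact OneEdgeAddition.girthGeFour_addChord F12.girthGeFour
      (F12.isLink_iff.2 ⟨rfl, (F12.adj_case i).1⟩) (F12.isLink_iff.2 ⟨rfl, (F12.adj_case i).2⟩)
      (F12.disjoint_case i)
  · exact F12.exists_extendsToChord_case i
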